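/- Call a finite set $T\subset\mathbb{R}^n$ *transitive* if some group of isometries of $\mathbb{R}^n$, each mapping $T$ onto itself, acts transitively on $T$. Call a set $X\subset\mathbb{R}^d$ *subtransitive* if, for some $n$, some affine isometric embedding $\mathbb{R}^d\to\mathbb{R}^n$ sends $X$ into a transitive set in $\mathbb{R}^n$, and *affinely subtransitive* if, for some $n$, some nonconstant affine map $\mathbb{R}^d\to\mathbb{R}^n$, $x\mapsto Ax+b$, sends $X$ into a transitive set in $\mathbb{R}^n$. Theorem. Let $d\ge 2$, and equip $(S^{d-1})^{d+2}$, where $S^{d-1}\subset\mathbb{R}^d$ is the unit sphere, with the product of the surface measures. For almost every $(x_0,\dots,x_{d+1})\in(S^{d-1})^{d+2}$ the set $\{x_0,\dots,x_{d+1}\}$ is not affinely subtransitive. In particular, for almost every $(x_0,\dots,x_{d+1})$ this set is not subtransitive. The number $d+2$ is sharp: for every $d\ge 0$, every set of $d+1$ affinely independent points of $\mathbb{R}^d$ is subtransitive. -/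

import Mathlib

open MeasureTheory

namespace Subtransitive

/-- A finite set `T ⊆ ℝⁿ` is transitive if some group of symmetries of `T`, i.e. of isometries of
`ℝⁿ` that map `T` onto itself, acts transitively on `T`. -/
def IsTransitiveSet {n : ℕ} (T : Set (EuclideanSpace ℝ (Fin n))) : Prop :=
  T.Finite ∧
    ∃ G : Subgroup (EuclideanSpace ℝ (Fin n) ≃ᵢ EuclideanSpace ℝ (Fin n)),
      (∀ g ∈ G, g '' T = T) ∧ ∀ x ∈ T, ∀ y ∈ T, ∃ g ∈ G, g x = y

/-- A set `X ⊆ ℝᵈ` is subtransitive if it is a subset of a transitive set in some `ℝⁿ`, where `ℝᵈ`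
is viewed inside `ℝⁿ` by an affine isometric embedding. -/
def IsSubtransitive {d : ℕ} (X : Set (EuclideanSpace ℝ (Fin d))) : Prop :=
  ∃ (n : ℕ) (φ : EuclideanSpace ℝ (Fin d) →ᵃⁱ[ℝ] EuclideanSpace ℝ (Fin n))
    (T : Set (EuclideanSpace ℝ (Fin n))),
    IsTransitiveSet T ∧ ∀ x ∈ X, φ x ∈ T

/-- A set `X ⊆ ℝᵈ` is affinely subtransitive if some nonconstant affine map from `ℝᵈ` to some `ℝⁿ`
sends `X` into a transitive set. -/
def IsAffinelySubtransitive {d : ℕ} (X : Set (EuclideanSpace ℝ (Fin d))) : Prop :=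
  ∃ (n : ℕ) (f : EuclideanSpace ℝ (Fin d) →ᵃ[ℝ] EuclideanSpace ℝ (Fin n))
    (T : Set (EuclideanSpace ℝ (Fin n))),
    (∃ u v, f u ≠ f v) ∧ IsTransitiveSet T ∧ ∀ x ∈ X, f x ∈ T

/-- The surface measure on the unit sphere `S^{d-1} ⊆ ℝᵈ`. -/
noncomputable def surfaceMeasure (d : ℕ) :
    Measure (Metric.sphere (0 : EuclideanSpace ℝ (Fin d)) 1) :=
  (volume : Measure (EuclideanSpace ℝ (Fin d))).toSphere

end Subtransitive

/-!
*Generic points.* Suppose a nonconstant affine map `f` sends `x 0, …, x (d + 1)` into a transitive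
set `T`, say `f (x i) = σ i (f (x 0))` with symmetries `σ i` of `T`. An affine dependence
`∑ c i • x i = 0`, `∑ c i = 0` is respected by `f` and by the symmetries of `T`, all affine, so
every coordinate of the points `τ (f (x 0))`, as a function `h` of the permutation `τ` of `T`,
satisfies `∑ c i * h (τ * σ i) = 0` (`exists_function_of_isAffinelySubtransitive`). Some such `h` is
not constant, and this is the vanishing of a polynomial in `c`, the determinant of
`translationMatrix`. There are only countably many choices of the finite permutation group and its
generators, so it is enough to exclude one of them almost everywhere. By Cramer's rule `c` is a
polynomial in the points (`dependence`), hence so is the determinant, and an analytic function on a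
product of spheres of positive dimension is nonzero almost everywhere unless it vanishes identically
(`ae_ne_zero_of_contDiff`). It does not: when all `c i` but one are positive the determinant is
nonzero by the maximum principle (`translationMatrix_det_ne_zero`). Such `c` are not dependences of
distinct points on a sphere, but those near `(1, -1, 1, -1, 0, …, 0)` are
(`eventually_exists_unit`), and the determinant is analytic along the line joining the two
(`exists_unit_det_ne_zero`).

*Simplices.* All signed rearrangements of one vector of `ℝᵐ` form a transitive set, so it is enough
to find vectors with the same distances as the vertices which are signed rearrangements of each
other. Their Gram matrices form a convex cone (`IsGram`). It contains all diagonally dominant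
matrices with constant diagonal (`isGram_of_diagonally_dominant`), so it suffices that it is dense
among positive semidefinite matrices with constant diagonal (`exists_isGram_near`): a positive
definite `K` is then the sum of a member of the cone near `K - δ I` and a diagonally dominant matrix
(`isGram_of_linearIndependent`). Density rests on the scale invariance of `z ↦ z ^ (-1/2)`. The
functions `a * z ^ (-1/2)` on `(0, ∞)` take absolute values above `v` on a set of length
`a ^ 2 / v ^ 2`, so a block of such functions with coefficients `a 1, …, a r` has a distribution
that only depends on `∑ a k ^ 2`, while the inner products of the blocks, cut off at `z ≤ Q`, are
asymptotic to `log Q * ∑ a k * b k`. For rational `a k ^ 2` the discretization `profile` keeps the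
distributions exactly equal.
-/

namespace Subtransitive

open scoped Pointwise ContDiff Topology
open Filter

/-! ### Zeros of analytic functions on products of spheres -/

/-- A measurable set is Lebesgue null as soon as almost every line through some base point `y`
meets it in a null set. -/
lemma measure_eq_zero_of_lines {E : Type*} [NormedAddCommGroup E] [NormedSpace ℝ E]
    [FiniteDimensional ℝ E] [MeasurableSpace E] [BorelSpace E] (μ : Measure E)
    [μ.IsAddHaarMeasure] {Z : Set E} (hZ : MeasurableSet Z) (y : E)
    (h : ∀ᵐ u ∂μ, ∀ᵐ t : ℝ, y + t • u ∉ Z) : μ Z = 0 := by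
  have hm : MeasurableSet {p : E × ℝ | y + p.2 • p.1 ∉ Z} := by
    have : Measurable fun p : E × ℝ => y + p.2 • p.1 := by fun_prop
    exact this hZ.compl
  -- By Fubini, for almost every `t` the dilate `{u | y + t • u ∈ Z}` of `Z` is null.
  have h' : ∀ᵐ t : ℝ, ∀ᵐ u ∂μ, y + t • u ∉ Z := (Measure.ae_ae_comm hm).1 h
  obtain ⟨t, ht, ht0⟩ := (h'.and (Measure.ae_ne volume (0 : ℝ))).exists
  have h2 : μ ((t • ·) ⁻¹' ((y + ·) ⁻¹' Z)) = 0 := by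
    rw [ae_iff] at ht
    simpa [Set.preimage] using ht
  rw [Measure.addHaar_preimage_smul μ ht0, measure_preimage_add] at h2
  refine (mul_eq_zero.1 h2).resolve_left ?_
  simp [ht0]

section Sphere

variable {E : Type*} [NormedAddCommGroup E] [InnerProductSpace ℝ E]

/-- Radial projection onto the unit sphere, with the value `e` at the origin. -/
noncomputable def radialProj (e : Metric.sphere (0 : E) 1) (y : E) : Metric.sphere (0 : E) 1 :=
  open Classical in
  if h : y = 0 then e else ⟨‖y‖⁻¹ • y, by simp [norm_smul, h]⟩

lemma coe_radialProj (e : Metric.sphere (0 : E) 1) {y : E} (h : y ≠ 0) :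
    (radialProj e y : E) = ‖y‖⁻¹ • y := by
  simp [radialProj, h]

variable [FiniteDimensional ℝ E] [MeasurableSpace E] [BorelSpace E]

lemma measurable_radialProj (e : Metric.sphere (0 : E) 1) : Measurable (radialProj e) := by
  refine Measurable.subtype_mk (p := (· ∈ Metric.sphere (0 : E) 1))
    (f := fun y => (radialProj e y : E)) ?_ (h := fun y => (radialProj e y).2)
  have : (fun y : E => (radialProj e y : E)) =
      open Classical in fun y => if y = 0 then (e : E) else ‖y‖⁻¹ • y := by
    funext y
    by_cases h : y = 0
    · simp [radialProj, h]
    · simp [coe_radialProj e h, h]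
  rw [this]
  exact Measurable.ite (measurableSet_singleton 0) measurable_const (by fun_prop)

/-- The surface measure is the image of a multiple of Lebesgue measure on the unit ball under
radial projection. -/
lemma toSphere_eq_map [Nontrivial E] (μ : Measure E) [μ.IsAddHaarMeasure]
    (e : Metric.sphere (0 : E) 1) :
    μ.toSphere = ((Module.finrank ℝ E : ENNReal) • μ.restrict (Metric.ball 0 1)).map
      (radialProj e) := by
  ext s hs
  rw [Measure.toSphere_apply' μ hs, Measure.map_apply (measurable_radialProj e) hs,
    Measure.smul_apply, Measure.restrict_apply (measurable_radialProj e hs), smul_eq_mul]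
  congr 1
  have h0 : (radialProj e ⁻¹' s ∩ Metric.ball 0 1 : Set E) \ {0} =
      Set.Ioo (0 : ℝ) 1 • ((↑) '' s) := by
    ext y
    simp only [Set.mem_sdiff, Set.mem_inter_iff, Set.mem_preimage, mem_ball_zero_iff,
      Set.mem_singleton_iff, Set.mem_smul, Set.mem_Ioo, Set.mem_image]
    constructor
    · rintro ⟨⟨h1, h2⟩, h3⟩
      refine ⟨‖y‖, ⟨norm_pos_iff.2 h3, h2⟩, _, ⟨_, h1, rfl⟩, ?_⟩
      rw [coe_radialProj e h3, smul_inv_smul₀ (norm_ne_zero_iff.2 h3)]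
    · rintro ⟨r, ⟨hr0, hr1⟩, _, ⟨x, hx, rfl⟩, rfl⟩
      have hx1 : ‖(x : E)‖ = 1 := by simp
      have hn : ‖r • (x : E)‖ = r := by rw [norm_smul, hx1, mul_one, Real.norm_of_nonneg hr0.le]
      have hne : r • (x : E) ≠ 0 := norm_pos_iff.1 (by rwa [hn])
      have : radialProj e (r • (x : E)) = x := by
        ext1
        rw [coe_radialProj e hne, hn, inv_smul_smul₀ hr0.ne']
      exact ⟨⟨by rwa [this], by rwa [hn]⟩, hne⟩
  rw [← h0, measure_sdiff_null (measure_singleton _)]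

/-- A property of tuples of unit vectors that holds for almost every tuple of vectors after
normalization holds almost everywhere for the product of the surface measures. -/
lemma ae_pi_toSphere {ι : Type*} [Fintype ι] (hE : 1 < Module.finrank ℝ E) (μ : Measure E)
    [μ.IsAddHaarMeasure] {F : (ι → E) → ℝ} (hF : Continuous F)
    (h : ∀ᵐ y ∂(Measure.pi fun _ : ι => μ), F (fun i => ‖y i‖⁻¹ • y i) ≠ 0) :
    ∀ᵐ x : ι → Metric.sphere (0 : E) 1 ∂(Measure.pi fun _ => μ.toSphere),
      F (fun i => x i) ≠ 0 := by
  have : Nontrivial E := Module.nontrivial_of_finrank_pos (R := ℝ) (by omega)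
  obtain ⟨e⟩ : Nonempty (Metric.sphere (0 : E) 1) :=
    (NormedSpace.sphere_nonempty.2 zero_le_one).to_subtype
  set ν : Measure E := (Module.finrank ℝ E : ENNReal) • μ.restrict (Metric.ball 0 1) with hν
  have hνf : IsFiniteMeasure ν := by
    refine ⟨?_⟩
    simp only [hν, Measure.smul_apply, Measure.restrict_apply_univ, smul_eq_mul]
    exact ENNReal.mul_lt_top (ENNReal.natCast_lt_top _) measure_ball_lt_top
  have hpi : Measure.pi (fun _ : ι => ν) = (Module.finrank ℝ E : ENNReal) ^ Fintype.card ι •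
      (Measure.pi fun _ : ι => μ).restrict (Set.univ.pi fun _ => Metric.ball 0 1) := by
    refine Measure.pi_eq fun s hs => ?_
    rw [Measure.restrict_pi_pi, Measure.smul_apply, Measure.pi_pi]
    simp [hν, Finset.prod_mul_distrib]
  have hae : ∀ᵐ y ∂(Measure.pi fun _ : ι => ν), F (fun i => radialProj e (y i)) ≠ 0 := by
    rw [hpi]
    refine Measure.ae_smul_measure (ae_restrict_of_ae ?_) _
    have h0 : ∀ᵐ y ∂(Measure.pi fun _ : ι => μ), ∀ i, y i ≠ 0 :=
      Filter.eventually_all.2 fun i => Measure.ae_eval_ne (μ := fun _ : ι => μ) i 0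
    filter_upwards [h, h0] with y hy hy0
    simpa only [coe_radialProj e (hy0 _)] using hy
  have hmap : Measure.pi (fun _ : ι => μ.toSphere) =
      (Measure.pi fun _ : ι => ν).map fun y i => radialProj e (y i) := by
    rw [Measure.pi_map_pi fun _ => (measurable_radialProj e).aemeasurable]
    simp_rw [toSphere_eq_map μ e]
    rfl
  rw [hmap, ae_map_iff]
  · exact hae
  · exact (measurable_pi_lambda _ fun i =>
      (measurable_radialProj e).comp (measurable_pi_apply i)).aemeasurable
  · have hc : Continuous fun x : ι → Metric.sphere (0 : E) 1 => F fun i => x i := by fun_prop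
    exact (isOpen_ne.preimage hc).measurableSet

/-- An analytic function on tuples of vectors which does not vanish at one tuple of unit vectors
is nonzero at almost every tuple of unit vectors. Spheres of dimension at least one are connected,
and this enters through the fact that almost every line avoids the origin. -/
theorem ae_ne_zero_of_contDiff {ι : Type*} [Fintype ι] (hE : 1 < Module.finrank ℝ E)
    (μ : Measure E) [μ.IsAddHaarMeasure] {F : (ι → E) → ℝ} (hF : ContDiff ℝ ω F) {e : ι → E}
    (he : ∀ i, ‖e i‖ = 1) (hFe : F e ≠ 0) :
    ∀ᵐ x : ι → Metric.sphere (0 : E) 1 ∂(Measure.pi fun _ => μ.toSphere),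
      F (fun i => x i) ≠ 0 := by
  refine ae_pi_toSphere hE μ hF.continuous ?_
  set Z : Set (ι → E) := {y | F (fun i => ‖y i‖⁻¹ • y i) = 0} with hZ
  have hZm : MeasurableSet Z := by
    have : Measurable fun y : ι → E => F (fun i => ‖y i‖⁻¹ • y i) :=
      hF.continuous.measurable.comp (measurable_pi_lambda _ fun i => by fun_prop)
    exact this (measurableSet_singleton 0)
  suffices h : (Measure.pi fun _ : ι => μ) Z = 0 by
    rw [ae_iff]
    simpa [hZ] using h
  refine measure_eq_zero_of_lines _ hZm e ?_
  have hu : ∀ᵐ u ∂(Measure.pi fun _ : ι => μ), ∀ i, u i ∉ Submodule.span ℝ {e i} := by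
    refine Filter.eventually_all.2 fun i => ?_
    have hspan : μ (Submodule.span ℝ {e i} : Submodule ℝ E) = 0 := by
      refine Measure.addHaar_submodule μ _ fun htop => ?_
      have := finrank_span_singleton (K := ℝ) (v := e i) (by
        intro h0
        simpa [h0] using he i)
      rw [htop, finrank_top] at this
      omega
    have := Measure.pi_eval_preimage_null (μ := fun _ : ι => μ) (i := i) hspan
    rw [ae_iff]
    simp only [not_not]
    exact this
  filter_upwards [hu] with u hu
  have hne : ∀ i (t : ℝ), e i + t • u i ≠ 0 := by
    intro i t h0
    rcases eq_or_ne t 0 with rfl | ht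
    · have := he i
      simp only [zero_smul, add_zero] at h0
      simp [h0] at this
    · refine hu i (Submodule.mem_span_singleton.2 ⟨-t⁻¹, ?_⟩)
      rw [add_eq_zero_iff_eq_neg.1 h0, smul_neg, neg_smul, neg_neg, inv_smul_smul₀ ht]
  have han : AnalyticOnNhd ℝ
      (fun t : ℝ => F (fun i => ‖e i + t • u i‖⁻¹ • (e i + t • u i))) Set.univ := by
    intro t _
    refine ContDiffAt.analyticAt (ContDiffAt.comp t hF.contDiffAt ?_)
    refine contDiffAt_pi.2 fun i => ?_
    have h1 : ContDiffAt ℝ ω (fun t : ℝ => e i + t • u i) t :=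
      contDiffAt_const.add (contDiffAt_id.smul contDiffAt_const)
    exact ((h1.norm ℝ (hne i t)).inv (norm_ne_zero_iff.2 (hne i t))).smul h1
  have hcod := han.preimage_zero_mem_codiscrete (x := 0) (by simpa [he] using hFe)
  have := ae_restrict_le_codiscreteWithin (μ := (volume : Measure ℝ)) MeasurableSet.univ hcod
  rw [Measure.restrict_univ] at this
  filter_upwards [this] with t ht
  simpa [hZ] using ht

end Sphere

/-! ### Relations between right translations on a finite group -/

section Group

variable {H : Type*} [Group H] [Fintype H] {ι : Type*} [Fintype ι]

lemma sum_sum_translate (g : ι → H) (c : ι → ℝ) (h : H → ℝ) :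
    ∑ a, ∑ i, c i * h (a * g i) = (∑ i, c i) * ∑ b, h b := by
  rw [Finset.sum_comm, Finset.sum_mul]
  refine Finset.sum_congr rfl fun i _ => ?_
  rw [← Finset.mul_sum]
  congr 1
  exact Equiv.sum_comp (Equiv.mulRight (g i)) h

variable [DecidableEq H]

/-- The matrix of the operator `h ↦ (a ↦ ∑ i, c i * h (a * g i) + ∑ b, h b)` on real functions on a
finite group. The second summand removes the constants from the kernel when `∑ i, c i = 0`. -/
def translationMatrix (g : ι → H) (c : ι → ℝ) : Matrix H H ℝ :=
  Matrix.of fun a b => ∑ i, c i * (if b = a * g i then 1 else 0) + 1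

open Matrix in
lemma translationMatrix_mulVec (g : ι → H) (c : ι → ℝ) (h : H → ℝ) (a : H) :
    (translationMatrix g c *ᵥ h) a = ∑ i, c i * h (a * g i) + ∑ b, h b := by
  simp only [translationMatrix, Matrix.mulVec, dotProduct, Matrix.of_apply, add_mul, one_mul,
    Finset.sum_add_distrib, Finset.sum_mul]
  rw [Finset.sum_comm]
  simp

lemma translationMatrix_det_eq_zero_iff (g : ι → H) {c : ι → ℝ} (hc : ∑ i, c i = 0) :
    (translationMatrix g c).det = 0 ↔
      ∃ h : H → ℝ, (∃ a b, h a ≠ h b) ∧ ∀ a, ∑ i, c i * h (a * g i) = 0 := by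
  have hcard : (Fintype.card H : ℝ) ≠ 0 := Nat.cast_ne_zero.2 Fintype.card_ne_zero
  rw [← Matrix.exists_mulVec_eq_zero_iff]
  constructor
  · rintro ⟨h, h0, hh⟩
    have h1 : ∀ a, ∑ i, c i * h (a * g i) + ∑ b, h b = 0 := fun a => by
      rw [← translationMatrix_mulVec, hh, Pi.zero_apply]
    have h2 : ∑ b, h b = 0 := by
      have := Finset.sum_congr rfl fun a (_ : a ∈ Finset.univ) => h1 a
      rw [Finset.sum_add_distrib, sum_sum_translate, hc] at this
      simpa [hcard] using this
    refine ⟨h, ?_, fun a => by simpa [h2] using h1 a⟩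
    by_contra! hconst
    apply h0
    funext a
    have h3 : ∑ b, h b = Fintype.card H * h a := by
      simp [hconst _ a]
    simpa [h2, hcard] using h3
  · rintro ⟨h, ⟨a, b, hab⟩, hh⟩
    set m : ℝ := (∑ b, h b) / Fintype.card H with hm
    refine ⟨fun b => h b - m, fun h0 => hab ?_, ?_⟩
    · have h1 := congrFun h0 a
      have h2 := congrFun h0 b
      simp only [Pi.zero_apply] at h1 h2
      linarith
    · funext a
      rw [translationMatrix_mulVec]
      simp only [mul_sub, Finset.sum_sub_distrib, ← Finset.sum_mul, hh, hc, Finset.sum_const,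
        Finset.card_univ, nsmul_eq_mul, Pi.zero_apply, hm]
      field_simp
      ring

/-- If all coefficients but one are positive, then the maximum principle leaves only the constant
solutions of the relation, so that the matrix is invertible. -/
lemma translationMatrix_det_ne_zero (g : ι → H) (hg : Subgroup.closure (Set.range g) = ⊤) {i₀ : ι}
    (hg0 : g i₀ = 1) {c : ι → ℝ} (hc : ∑ i, c i = 0) (hpos : ∀ i, i ≠ i₀ → 0 < c i) :
    (translationMatrix g c).det ≠ 0 := by
  rw [Ne, translationMatrix_det_eq_zero_iff g hc]
  rintro ⟨h, ⟨a, b, hab⟩, hh⟩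
  obtain ⟨z, hz⟩ := Finite.exists_max h
  -- The set where `h` is maximal is stable under right translation by each `g i`: the terms of the
  -- relation at such a point are all nonnegative.
  have step : ∀ y, h y = h z → ∀ i, h (y * g i) = h z := by
    intro y hy i
    have h1 : ∑ i, c i * (h z - h (y * g i)) = 0 := by
      simp [mul_sub, Finset.sum_sub_distrib, ← Finset.sum_mul, hc, hh]
    have h2 : ∀ i ∈ Finset.univ, 0 ≤ c i * (h z - h (y * g i)) := by
      intro i _
      by_cases hi : i = i₀
      · simp [hi, hg0, hy]
      · exact mul_nonneg (hpos i hi).le (sub_nonneg.2 (hz _))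
    have h3 := (Finset.sum_eq_zero_iff_of_nonneg h2).1 h1 i (Finset.mem_univ i)
    by_cases hi : i = i₀
    · simp [hi, hg0, hy]
    · have := (mul_eq_zero.1 h3).resolve_left (hpos i hi).ne'
      linarith
  -- In a finite group the submonoid generated by the `g i` is already the whole group.
  have hall : ∀ x : H, h (z * x) = h z := by
    intro x
    have hx : x ∈ Submonoid.closure (Set.range g) := by
      rw [← Subgroup.closure_toSubmonoid_of_finite, hg]
      trivial
    have : ∀ y, h y = h z → h (y * x) = h z := by
      induction hx using Submonoid.closure_induction with
      | mem x hx =>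
        obtain ⟨i, rfl⟩ := hx
        exact fun y hy => step y hy i
      | one => simp
      | mul x y _ _ hx hy =>
        intro u hu
        rw [← mul_assoc]
        exact hy _ (hx _ hu)
    exact this z rfl
  apply hab
  rw [← mul_inv_cancel_left z a, ← mul_inv_cancel_left z b, hall, hall]

end Group

lemma contDiff_matrix_det {V : Type*} [NormedAddCommGroup V] [NormedSpace ℝ V] {n : Type*}
    [Fintype n] [DecidableEq n] {A : V → Matrix n n ℝ} (hA : ∀ i j, ContDiff ℝ ω fun v => A v i j) :
    ContDiff ℝ ω fun v => (A v).det := by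
  simp only [Matrix.det_apply']
  refine ContDiff.sum fun σ _ => ?_
  exact contDiff_const.mul (contDiff_prod fun i _ => hA _ _)

lemma contDiff_translationMatrix_det {V : Type*} [NormedAddCommGroup V] [NormedSpace ℝ V]
    {H : Type*} [Group H] [Fintype H] [DecidableEq H] {ι : Type*} [Fintype ι] (g : ι → H)
    {c : V → ι → ℝ} (hc : ∀ i, ContDiff ℝ ω fun v => c v i) :
    ContDiff ℝ ω fun v => (translationMatrix g (c v)).det := by
  refine contDiff_matrix_det fun a b => ?_
  simp only [translationMatrix, Matrix.of_apply]
  exact (ContDiff.sum fun i _ => (hc i).mul contDiff_const).add contDiff_const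

/-! ### The affine dependence of `d + 2` points in `ℝᵈ` -/

section Dependence

variable {d : ℕ}

/-- The square matrix whose columns are `(δ, 1, x j)`, where `δ` is `1` for `j = 0` and `0`
otherwise. Its determinant is, up to sign, the one that detects affine independence of the points
`x 1, …, x (d + 1)`. -/
def affineMatrix (x : Fin (d + 2) → EuclideanSpace ℝ (Fin d)) :
    Matrix (Fin (d + 2)) (Fin (d + 2)) ℝ :=
  Matrix.of fun k j => (Fin.cons (if j = 0 then 1 else 0) (Fin.cons 1 fun l => x j l) :
    Fin (d + 2) → ℝ) k

open Matrix

lemma affineMatrix_mulVec (x : Fin (d + 2) → EuclideanSpace ℝ (Fin d)) (c : Fin (d + 2) → ℝ) :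
    affineMatrix x *ᵥ c = Fin.cons (c 0) (Fin.cons (∑ j, c j) fun l => ∑ j, c j * x j l) := by
  funext k
  refine Fin.cases ?_ (fun k => Fin.cases ?_ (fun l => ?_) k) k
  · simp [affineMatrix, Matrix.mulVec, dotProduct]
  · simp [affineMatrix, Matrix.mulVec, dotProduct]
  · simp [affineMatrix, Matrix.mulVec, dotProduct, mul_comm]

/-- The coefficients of an affine dependence of `d + 2` points in `ℝᵈ`, as polynomials in the
coordinates of the points (Cramer's rule). -/
noncomputable def dependence (x : Fin (d + 2) → EuclideanSpace ℝ (Fin d)) (j : Fin (d + 2)) : ℝ :=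
  (affineMatrix x).adjugate j 0

lemma affineMatrix_mulVec_dependence (x : Fin (d + 2) → EuclideanSpace ℝ (Fin d)) :
    affineMatrix x *ᵥ dependence x = Pi.single 0 (affineMatrix x).det := by
  funext k
  have := congrFun (congrFun (Matrix.mul_adjugate (affineMatrix x)) k) 0
  rw [Matrix.mul_apply] at this
  simp only [Matrix.mulVec, dotProduct, dependence, this, Matrix.smul_apply, Matrix.one_apply,
    Pi.single_apply]
  simp

lemma sum_dependence (x : Fin (d + 2) → EuclideanSpace ℝ (Fin d)) : ∑ j, dependence x j = 0 := by
  have := congrFun (affineMatrix_mulVec_dependence x) (Fin.succ 0)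
  rw [affineMatrix_mulVec] at this
  simpa only [Fin.cons_succ, Fin.cons_zero, Pi.single_eq_of_ne (Fin.succ_ne_zero _)] using this

lemma sum_dependence_smul (x : Fin (d + 2) → EuclideanSpace ℝ (Fin d)) :
    ∑ j, dependence x j • x j = 0 := by
  ext l
  have := congrFun (affineMatrix_mulVec_dependence x) l.succ.succ
  rw [affineMatrix_mulVec] at this
  simpa using this

lemma smul_dependence (x : Fin (d + 2) → EuclideanSpace ℝ (Fin d)) {c : Fin (d + 2) → ℝ}
    (h1 : ∑ j, c j = 0) (h2 : ∑ j, c j • x j = 0) :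
    c 0 • dependence x = (affineMatrix x).det • c := by
  have h3 : affineMatrix x *ᵥ c = Pi.single 0 (c 0) := by
    rw [affineMatrix_mulVec]
    funext k
    refine Fin.cases ?_ (fun k => Fin.cases ?_ (fun l => ?_) k) k
    · simp
    · simp [h1]
    · have := congrArg (fun v : EuclideanSpace ℝ (Fin d) => v l) h2
      simpa using this
  have h4 := congrArg ((affineMatrix x).adjugate *ᵥ ·) h3
  simp only [Matrix.mulVec_mulVec, Matrix.adjugate_mul, Matrix.smul_mulVec, Matrix.one_mulVec] at h4
  rw [h4]
  funext j
  simp [dependence, mul_comm]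

lemma contDiff_affineMatrix_apply (k j : Fin (d + 2)) :
    ContDiff ℝ ω fun x : Fin (d + 2) → EuclideanSpace ℝ (Fin d) => affineMatrix x k j := by
  refine Fin.cases ?_ (fun k => Fin.cases ?_ (fun l => ?_) k) k
  · simpa [affineMatrix] using contDiff_const
  · simpa [affineMatrix] using contDiff_const
  · simp only [affineMatrix, Matrix.of_apply, Fin.cons_succ]
    fun_prop

lemma contDiff_affineMatrix_det :
    ContDiff ℝ ω fun x : Fin (d + 2) → EuclideanSpace ℝ (Fin d) => (affineMatrix x).det :=
  contDiff_matrix_det contDiff_affineMatrix_apply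

lemma contDiff_dependence (j : Fin (d + 2)) :
    ContDiff ℝ ω fun x : Fin (d + 2) → EuclideanSpace ℝ (Fin d) => dependence x j := by
  simp only [dependence, Matrix.adjugate_apply]
  refine contDiff_matrix_det fun k l => ?_
  simp only [Matrix.updateRow_apply]
  split_ifs
  · exact contDiff_const
  · exact contDiff_affineMatrix_apply k l

lemma sum_smul_affineMap_eq_zero {ι V W : Type*} [Fintype ι] [AddCommGroup V] [Module ℝ V]
    [AddCommGroup W] [Module ℝ W] (f : V →ᵃ[ℝ] W) {c : ι → ℝ} {x : ι → V} (h1 : ∑ i, c i = 0)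
    (h2 : ∑ i, c i • x i = 0) : ∑ i, c i • f (x i) = 0 := by
  have hf : ∀ i, f (x i) = f.linear (x i) + f 0 := fun i => congrFun f.decomp (x i)
  simp only [hf, smul_add, Finset.sum_add_distrib, ← Finset.sum_smul, h1, zero_smul, add_zero]
  simp only [← map_smul, ← map_sum, h2, map_zero]

/-- Points with nonzero affine determinant span: a nonconstant affine map separates them. -/
lemma exists_affineMap_ne {n : ℕ} {x : Fin (d + 2) → EuclideanSpace ℝ (Fin d)}
    (hdet : (affineMatrix x).det ≠ 0)
    (f : EuclideanSpace ℝ (Fin d) →ᵃ[ℝ] EuclideanSpace ℝ (Fin n)) (hf : ∃ u v, f u ≠ f v) :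
    ∃ i, f (x i) ≠ f (x 0) := by
  by_contra! hall
  have hL : ∀ j, f.linear (x j) = f.linear (x 0) := by
    intro j
    have := f.linearMap_vsub (x j) (x 0)
    rw [hall j, vsub_self, vsub_eq_sub, map_sub] at this
    exact sub_eq_zero.1 this
  have hzero : f.linear = 0 := by
    refine (EuclideanSpace.basisFun (Fin d) ℝ).toBasis.ext fun l => ?_
    ext k
    have hv : (Fin.cons 0 (Fin.cons (-f.linear (x 0) k) fun l =>
        f.linear (EuclideanSpace.basisFun (Fin d) ℝ l) k) : Fin (d + 2) → ℝ) ᵥ* affineMatrix x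
          = 0 := by
      funext j
      simp only [Matrix.vecMul, dotProduct, affineMatrix, Matrix.of_apply, Fin.sum_univ_succ,
        Fin.cons_zero, Fin.cons_succ, zero_mul, zero_add, mul_one, Pi.zero_apply]
      have h1 : x j = ∑ l, x j l • EuclideanSpace.basisFun (Fin d) ℝ l := by
        simpa using ((EuclideanSpace.basisFun (Fin d) ℝ).sum_repr (x j)).symm
      have h2 := congrArg (fun v : EuclideanSpace ℝ (Fin n) => v k) (hL j)
      simp only at h2
      rw [← h2]
      conv_lhs => enter [1, 1]; rw [h1]
      simp [mul_comm]
    have := congrFun (Matrix.eq_zero_of_vecMul_eq_zero hdet hv) l.succ.succ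
    simpa using this
  obtain ⟨u, v, huv⟩ := hf
  apply huv
  have := f.linearMap_vsub u v
  rw [hzero, LinearMap.zero_apply] at this
  exact (vsub_eq_zero_iff_eq.1 this.symm)

end Dependence

/-! ### Functions on the permutation group of a transitive set -/

/-- A family in a group, viewed inside the subgroup that it generates. -/
def generator {ι K : Type*} [Group K] (σ : ι → K) (i : ι) : Subgroup.closure (Set.range σ) :=
  ⟨σ i, Subgroup.subset_closure ⟨i, rfl⟩⟩

lemma closure_range_generator {ι K : Type*} [Group K] (σ : ι → K) :
    Subgroup.closure (Set.range (generator σ)) = ⊤ := by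
  rw [← Subgroup.closure_closure_coe_preimage (k := Set.range σ)]
  congr 1
  ext ⟨a, ha⟩
  simp [generator, Subtype.ext_iff]

/-- A set that is affinely subtransitive yields a nonconstant function on a finite permutation group
which satisfies, after right translations, every affine dependence of the set. The function sends a
permutation `τ` of the transitive set to a coordinate of the point `τ (f (x 0))`. -/
lemma exists_function_of_isAffinelySubtransitive {d : ℕ}
    {x : Fin (d + 2) → EuclideanSpace ℝ (Fin d)}
    (hdet : (affineMatrix x).det ≠ 0) (hx : IsAffinelySubtransitive (Set.range x)) :
    ∃ (m : ℕ) (σ : Fin (d + 2) → Equiv.Perm (Fin m)), σ 0 = 1 ∧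
      ∃ h : Subgroup.closure (Set.range σ) → ℝ, (∃ a b, h a ≠ h b) ∧
        ∀ c : Fin (d + 2) → ℝ, ∑ i, c i = 0 → ∑ i, c i • x i = 0 →
          ∀ a, ∑ i, c i * h (a * generator σ i) = 0 := by
  obtain ⟨n, f, T, hf, ⟨hfin, G, hG, htrans⟩, hfT⟩ := hx
  obtain ⟨i₁, hi₁⟩ := exists_affineMap_ne hdet f hf
  obtain ⟨k, hk⟩ : ∃ k, f (x i₁) k ≠ f (x 0) k := by
    by_contra! h
    exact hi₁ (by ext k; exact h k)
  have hT : ∀ i, f (x i) ∈ T := fun i => hfT _ ⟨i, rfl⟩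
  have hg : ∀ i, ∃ g ∈ G, g (f (x 0)) = f (x i) ∧ (i = 0 → g = 1) := by
    intro i
    by_cases hi : i = 0
    · exact ⟨1, G.one_mem, by simp [hi], fun _ => rfl⟩
    · obtain ⟨g, hg, h⟩ := htrans _ (hT 0) _ (hT i)
      exact ⟨g, hg, h, fun h => absurd h hi⟩
  choose g hgG hgx hg0 using hg
  have hgT : ∀ i y, g i y ∈ T ↔ y ∈ T := by
    intro i y
    conv_lhs => rw [← hG _ (hgG i)]
    exact (g i).injective.mem_set_image
  have : Finite T := hfin
  obtain ⟨m, ⟨e⟩⟩ := Finite.exists_equiv_fin T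
  set σ : Fin (d + 2) → Equiv.Perm (Fin m) := fun i =>
    e.permCongr (Equiv.Perm.subtypePerm (p := (· ∈ T)) (g i).toEquiv (hgT i)) with hσ
  have hσe : ∀ i (t : T), (e.symm (σ i (e t)) : EuclideanSpace ℝ (Fin n)) = g i t := by
    intro i t
    simp [hσ]
  -- Every permutation in the generated group is induced by an affine map of the ambient space.
  have haff : ∀ τ ∈ Subgroup.closure (Set.range σ),
      ∃ A : EuclideanSpace ℝ (Fin n) ≃ᵃ[ℝ] EuclideanSpace ℝ (Fin n),
        ∀ t : T, (e.symm (τ (e t)) : EuclideanSpace ℝ (Fin n)) = A t := by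
    intro τ hτ
    induction hτ using Subgroup.closure_induction with
    | mem τ hτ =>
      obtain ⟨i, rfl⟩ := hτ
      refine ⟨(g i).toRealAffineIsometryEquiv.toAffineEquiv, fun t => ?_⟩
      rw [hσe]
      simp
    | one => exact ⟨AffineEquiv.refl _ _, fun t => by simp⟩
    | mul τ τ' _ _ h h' =>
      obtain ⟨A, hA⟩ := h
      obtain ⟨A', hA'⟩ := h'
      refine ⟨A'.trans A, fun t => ?_⟩
      have := hA (e.symm (τ' (e t)))
      rw [Equiv.apply_symm_apply, hA'] at this
      simpa using this
    | inv τ _ h =>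
      obtain ⟨A, hA⟩ := h
      refine ⟨A.symm, fun t => ?_⟩
      apply A.injective
      rw [← hA, AffineEquiv.apply_symm_apply]
      simp
  refine ⟨m, σ, ?_, fun τ => (e.symm (τ.1 (e ⟨f (x 0), hT 0⟩)) : EuclideanSpace ℝ (Fin n)) k,
    ⟨generator σ i₁, 1, ?_⟩, ?_⟩
  · ext1 j
    apply e.symm.injective
    ext1
    have := hσe 0 (e.symm j)
    rw [Equiv.apply_symm_apply, hg0 0 rfl] at this
    simpa using this
  · simp only [generator, hσe, hgx]
    simpa using hk
  · intro c h1 h2 a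
    obtain ⟨A, hA⟩ := haff a.1 a.2
    have key : ∀ i, (e.symm ((a * generator σ i).1 (e ⟨f (x 0), hT 0⟩)) :
        EuclideanSpace ℝ (Fin n)) = (A.toAffineMap.comp f) (x i) := by
      intro i
      have := hA (e.symm (σ i (e ⟨f (x 0), hT 0⟩)))
      rw [Equiv.apply_symm_apply, hσe, hgx] at this
      simpa [generator] using this
    simp only [key]
    have := congrArg (fun v : EuclideanSpace ℝ (Fin n) => v k)
      (sum_smul_affineMap_eq_zero (A.toAffineMap.comp f) h1 h2)
    simpa using this

/-! ### Points on the sphere with a prescribed affine dependence -/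

section Configuration

open Matrix

/-- Unit vectors `x₀, x₁, e₁, …, e_d` with the dependence `c`. They exist as soon as `x₀` is a unit
vector such that `-(c₀ x₀ + ∑ cₗ₊₂ eₗ)` has length `|c₁|`, and they are in general position if `x₀`
is off the hyperplane through the `eₗ`. -/
lemma exists_unit_of_dependence {d : ℕ} {c : Fin (d + 2) → ℝ} (hc : ∑ j, c j = 0) (h0 : c 0 ≠ 0)
    (h1 : c (Fin.succ 0) ≠ 0) {y : Fin d → ℝ} (hy : ∑ l, y l ^ 2 = 1)
    (hy1 : ∑ l, (c 0 * y l + c l.succ.succ) ^ 2 = c (Fin.succ 0) ^ 2) (hys : ∑ l, y l ≠ 1) :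
    ∃ x : Fin (d + 2) → EuclideanSpace ℝ (Fin d),
      (∀ j, ‖x j‖ = 1) ∧ ∑ j, c j • x j = 0 ∧ (affineMatrix x).det ≠ 0 := by
  set z : Fin d → ℝ := fun l => -(c 0 * y l + c l.succ.succ) / c (Fin.succ 0) with hz
  have hcz : ∀ l, c (Fin.succ 0) * z l = -(c 0 * y l + c l.succ.succ) := fun l => by
    rw [hz]; field_simp
  have hzs : ∑ l, z l ≠ 1 := by
    intro h
    apply hys
    have h2 := congrArg (c (Fin.succ 0) * ·) h
    simp only [Finset.mul_sum, hcz, neg_add, Finset.sum_add_distrib, Finset.sum_neg_distrib] at h2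
    rw [← Finset.mul_sum] at h2
    rw [Fin.sum_univ_succ, Fin.sum_univ_succ] at hc
    have h3 : c 0 * (∑ l, y l - 1) = 0 := by linarith
    have := (mul_eq_zero.1 h3).resolve_left h0
    linarith
  refine ⟨Fin.cons (WithLp.toLp 2 y) (Fin.cons (WithLp.toLp 2 z) fun l =>
    EuclideanSpace.single l 1), ?_, ?_, ?_⟩
  · intro j
    refine Fin.cases ?_ (fun j => Fin.cases ?_ (fun l => ?_) j) j
    · simp [EuclideanSpace.norm_eq, hy]
    · have : ∑ l, z l ^ 2 = 1 := by
        simp only [hz, div_pow, neg_sq, ← Finset.sum_div, hy1]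
        exact div_self (pow_ne_zero 2 h1)
      simp [EuclideanSpace.norm_eq, this]
    · simp
  · ext l
    simp only [Fin.sum_univ_succ, Fin.cons_zero, Fin.cons_succ, PiLp.add_apply, PiLp.smul_apply,
      smul_eq_mul, WithLp.ofLp_sum, Finset.sum_apply, PiLp.single_apply, hcz]
    simp
  · intro hdet
    obtain ⟨v, hv, hMv⟩ := Matrix.exists_mulVec_eq_zero_iff.2 hdet
    rw [affineMatrix_mulVec] at hMv
    have hv0 : v 0 = 0 := by simpa using congrFun hMv 0
    have hvs : ∑ j, v j = 0 := by
      have := congrFun hMv (Fin.succ 0)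
      simpa only [Fin.cons_succ, Fin.cons_zero, Pi.zero_apply] using this
    have hvl : ∀ l : Fin d, v l.succ.succ = -(v (Fin.succ 0) * z l) := by
      intro l
      have := congrFun hMv l.succ.succ
      simp only [Fin.cons_succ, Fin.sum_univ_succ, Fin.cons_zero, Pi.zero_apply, hv0,
        PiLp.single_apply] at this
      simp at this
      simp
      linarith
    rw [Fin.sum_univ_succ, Fin.sum_univ_succ, hv0] at hvs
    simp only [hvl, Finset.sum_neg_distrib, ← Finset.mul_sum] at hvs
    have h3 : v (Fin.succ 0) * (∑ l, z l - 1) = 0 := by linarith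
    have hv1 := (mul_eq_zero.1 h3).resolve_right (sub_ne_zero.2 hzs)
    apply hv
    funext j
    refine Fin.cases hv0 (fun j => Fin.cases hv1 (fun l => ?_) j) j
    rw [hvl, hv1]
    simp

/-- The vector of coefficients moving on a line from `(1, -1, 1, -1, 0, …, 0)` at `s = 0` to
`(-(k + 3), 1, …, 1)` at `s = 1`. -/
def coeffLine (k : ℕ) (s : ℝ) : Fin (k + 2 + 2) → ℝ :=
  Fin.cons (1 - (k + 4) * s) (Fin.cons (2 * s - 1) (Fin.cons 1 (Fin.cons (2 * s - 1) fun _ => s)))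

lemma sum_coeffLine (k : ℕ) (s : ℝ) : ∑ j, coeffLine k s j = 0 := by
  simp only [coeffLine, Fin.sum_univ_succ, Fin.cons_zero, Fin.cons_succ, Finset.sum_const,
    Finset.card_univ, Fintype.card_fin, nsmul_eq_mul]
  ring

lemma contDiff_coeffLine (k : ℕ) (j : Fin (k + 2 + 2)) :
    ContDiff ℝ ω fun s => coeffLine k s j := by
  simp only [coeffLine]
  refine Fin.cases ?_ (fun j => Fin.cases ?_ (fun j => Fin.cases ?_ (fun j =>
    Fin.cases ?_ (fun l => ?_) j) j) j) j
  all_goals simp only [Fin.cons_zero, Fin.cons_succ]; fun_prop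

/-- Near the coefficients `(1, -1, 1, -1, 0, …, 0)` of a square the points can be chosen: the unit
vector of `exists_unit_of_dependence` lies in the plane spanned by `w = ∑ cₗ₊₂ eₗ` and the vector
`w' = (w₁, -w₀, 0, …)` orthogonal to it. -/
lemma eventually_exists_unit (k : ℕ) : ∀ᶠ s in nhds (0 : ℝ),
    coeffLine k s 0 ≠ 0 ∧ ∃ x : Fin (k + 2 + 2) → EuclideanSpace ℝ (Fin (k + 2)),
      (∀ j, ‖x j‖ = 1) ∧ ∑ j, coeffLine k s j • x j = 0 ∧ (affineMatrix x).det ≠ 0 := by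
  -- `W` and `q` are the squared lengths of `w` and `w'`; the solution is `α w + β w'`.
  set W : ℝ → ℝ := fun s => 1 + (2 * s - 1) ^ 2 + k * s ^ 2 with hW
  set q : ℝ → ℝ := fun s => 1 + (2 * s - 1) ^ 2 with hq
  set α : ℝ → ℝ := fun s =>
    ((2 * s - 1) ^ 2 - (1 - (k + 4) * s) ^ 2 - W s) / (2 * (1 - (k + 4) * s) * W s) with hα
  set β : ℝ → ℝ := fun s => √((1 - α s ^ 2 * W s) / q s) with hβ
  have hWpos : ∀ s, 0 < W s := fun s => by simp only [hW]; positivity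
  have hqpos : ∀ s, 0 < q s := fun s => by simp only [hq]; positivity
  have hWc : Continuous W := by fun_prop
  have hqc : Continuous q := by fun_prop
  have hαc : ContinuousAt α 0 := by
    refine ContinuousAt.div (by fun_prop) (by fun_prop) ?_
    simpa using (hWpos 0).ne'
  have hβc : ContinuousAt β 0 := by
    refine Real.continuous_sqrt.continuousAt.comp (ContinuousAt.div ?_ hqc.continuousAt
      (hqpos 0).ne')
    exact continuousAt_const.sub ((hαc.pow 2).mul hWc.continuousAt)
  have hα0 : α 0 = -1 / 2 := by simp only [hα, hW]; norm_num
  have hβ0 : β 0 = 1 / 2 := by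
    simp only [hβ, hα0, hW, hq]
    rw [Real.sqrt_eq_iff_mul_self_eq_of_pos] <;> norm_num
  have e1 : ∀ᶠ s in nhds (0 : ℝ), 1 - ((k : ℝ) + 4) * s ≠ 0 :=
    ContinuousAt.eventually_ne (by fun_prop) (by simp)
  have e2 : ∀ᶠ s in nhds (0 : ℝ), 2 * s - 1 ≠ 0 :=
    ContinuousAt.eventually_ne (by fun_prop) (by simp)
  have e3 : ∀ᶠ s in nhds (0 : ℝ), 0 < 1 - α s ^ 2 * W s := by
    refine ContinuousAt.eventually_lt (f := fun _ => (0 : ℝ)) continuousAt_const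
      (continuousAt_const.sub ((hαc.pow 2).mul hWc.continuousAt)) ?_
    simp only [hα0, hW]; norm_num
  have e4 : ∀ᶠ s in nhds (0 : ℝ), α s * (2 * s + k * s) + β s * (2 * s - 2) ≠ 1 := by
    refine ContinuousAt.eventually_ne ?_ ?_
    · exact (hαc.mul (by fun_prop)).add (hβc.mul (by fun_prop))
    · simp only [hβ0]; norm_num
  filter_upwards [e1, e2, e3, e4] with s h1 h2 h3 h4
  refine ⟨by simpa [coeffLine] using h1, ?_⟩
  have hβ2 : β s ^ 2 * q s = 1 - α s ^ 2 * W s := by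
    simp only [hβ]
    rw [Real.sq_sqrt (div_nonneg h3.le (hqpos s).le), div_mul_cancel₀ _ (hqpos s).ne']
  have hα2 : α s * (2 * (1 - (k + 4) * s) * W s) =
      (2 * s - 1) ^ 2 - (1 - (k + 4) * s) ^ 2 - W s := by
    simp only [hα]
    exact div_mul_cancel₀ _ (mul_ne_zero (mul_ne_zero two_ne_zero h1) (hWpos s).ne')
  refine exists_unit_of_dependence (c := coeffLine k s) (sum_coeffLine k s)
    (by simpa [coeffLine] using h1) (by simpa [coeffLine] using h2)
    (y := Fin.cons (α s + β s * (2 * s - 1)) (Fin.cons (α s * (2 * s - 1) - β s)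
      fun _ => α s * s)) ?_ ?_ ?_
  · simp only [Fin.sum_univ_succ, Fin.cons_zero, Fin.cons_succ, Finset.sum_const,
      Finset.card_univ, Fintype.card_fin, nsmul_eq_mul]
    simp only [hW, hq] at hβ2
    linear_combination hβ2
  · simp only [coeffLine, Fin.sum_univ_succ, Fin.cons_zero, Fin.cons_succ, Finset.sum_const,
      Finset.card_univ, Fintype.card_fin, nsmul_eq_mul]
    simp only [hW, hq] at hβ2 hα2
    linear_combination (1 - (k + 4) * s) ^ 2 * hβ2 + hα2
  · simp only [Fin.sum_univ_succ, Fin.cons_zero, Fin.cons_succ, Finset.sum_const,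
      Finset.card_univ, Fintype.card_fin, nsmul_eq_mul]
    intro h
    apply h4
    linear_combination h

/-- For permutations generating a group, some tuple of unit vectors has an affine dependence for
which the translation matrix is invertible: along `coeffLine` the determinant is analytic, it is
nonzero at `s = 1` by the maximum principle, and for small `s` the coefficients are realized. -/
lemma exists_unit_det_ne_zero {d : ℕ} (hd : 2 ≤ d) {H : Type*} [Group H] [Fintype H]
    [DecidableEq H] (g : Fin (d + 2) → H) (hg : Subgroup.closure (Set.range g) = ⊤)
    (hg0 : g 0 = 1) : ∃ x : Fin (d + 2) → EuclideanSpace ℝ (Fin d), (∀ j, ‖x j‖ = 1) ∧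
      (translationMatrix g (dependence x)).det * (affineMatrix x).det ≠ 0 := by
  obtain ⟨k, rfl⟩ : ∃ k, d = k + 2 := ⟨d - 2, by omega⟩
  have han : AnalyticOnNhd ℝ (fun s => (translationMatrix g (coeffLine k s)).det) Set.univ :=
    fun s _ => (contDiff_translationMatrix_det g (contDiff_coeffLine k)).contDiffAt.analyticAt
  have h1 : (translationMatrix g (coeffLine k 1)).det ≠ 0 := by
    refine translationMatrix_det_ne_zero g hg hg0 (sum_coeffLine k 1) fun j => ?_
    refine Fin.cases (fun h => absurd rfl h) (fun j _ => ?_) j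
    simp only [coeffLine, Fin.cons_succ]
    refine Fin.cases ?_ (fun j => Fin.cases ?_ (fun j => Fin.cases ?_ (fun l => ?_) j) j) j
    all_goals simp only [Fin.cons_succ, Fin.cons_zero]; norm_num
  have hne : ∀ᶠ s in nhdsWithin (0 : ℝ) {0}ᶜ, (translationMatrix g (coeffLine k s)).det ≠ 0 := by
    have h2 := (mem_codiscrete.1 (han.preimage_zero_mem_codiscrete h1)) 0
    rw [Filter.disjoint_principal_right, compl_compl] at h2
    exact h2
  obtain ⟨s, hs, hs0, x, hx1, hx2, hx3⟩ :=
    (hne.and ((eventually_exists_unit k).filter_mono nhdsWithin_le_nhds)).exists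
  refine ⟨x, hx1, mul_ne_zero ?_ hx3⟩
  have hdep := smul_dependence x (sum_coeffLine k s) hx2
  rw [Ne, translationMatrix_det_eq_zero_iff g (sum_dependence x)]
  rw [Ne, translationMatrix_det_eq_zero_iff g (sum_coeffLine k s)] at hs
  rintro ⟨h, hh, hrel⟩
  refine hs ⟨h, hh, fun a => ?_⟩
  have h2 : (affineMatrix x).det * ∑ i, coeffLine k s i * h (a * g i) = 0 := by
    have h3 : ∀ i, (affineMatrix x).det * coeffLine k s i = coeffLine k s 0 * dependence x i :=
      fun i => (congrFun hdep i).symm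
    simp only [Finset.mul_sum, ← mul_assoc, h3]
    simp only [mul_assoc, ← Finset.mul_sum, hrel, mul_zero]
  exact (mul_eq_zero.1 h2).resolve_left hx3

end Configuration

/-! ### Generic points of the sphere -/

theorem ae_not_isAffinelySubtransitive {d : ℕ} (hd : 2 ≤ d) :
    ∀ᵐ x : Fin (d + 2) → Metric.sphere (0 : EuclideanSpace ℝ (Fin d)) 1
      ∂(Measure.pi fun _ : Fin (d + 2) => surfaceMeasure d),
      ¬ IsAffinelySubtransitive (Set.range fun i => (x i : EuclideanSpace ℝ (Fin d))) := by
  classical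
  have key : ∀ (m : ℕ) (σ : Fin (d + 2) → Equiv.Perm (Fin m)), σ 0 = 1 →
      ∀ᵐ x : Fin (d + 2) → Metric.sphere (0 : EuclideanSpace ℝ (Fin d)) 1
        ∂(Measure.pi fun _ : Fin (d + 2) => surfaceMeasure d),
        (translationMatrix (generator σ) (dependence fun i => (x i).1)).det *
          (affineMatrix fun i => (x i).1).det ≠ 0 := by
    intro m σ hσ
    obtain ⟨e, he, hne⟩ := exists_unit_det_ne_zero hd (generator σ) (closure_range_generator σ)
      (Subtype.ext hσ)
    exact ae_ne_zero_of_contDiff (by rw [finrank_euclideanSpace_fin]; omega) volume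
      ((contDiff_translationMatrix_det _ contDiff_dependence).mul contDiff_affineMatrix_det) he hne
  simp only [← ae_all_iff] at key
  filter_upwards [key] with x hx hsub
  have hdet := right_ne_zero_of_mul (hx 0 (fun _ => 1) rfl)
  obtain ⟨m, σ, hσ, h, hh, hrel⟩ := exists_function_of_isAffinelySubtransitive hdet hsub
  refine left_ne_zero_of_mul (hx m σ hσ) ?_
  exact (translationMatrix_det_eq_zero_iff _ (sum_dependence _)).2
    ⟨h, hh, hrel _ (sum_dependence _) (sum_dependence_smul _)⟩

lemma IsSubtransitive.isAffinelySubtransitive {d : ℕ} (hd : d ≠ 0)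
    {X : Set (EuclideanSpace ℝ (Fin d))} (h : IsSubtransitive X) : IsAffinelySubtransitive X := by
  obtain ⟨n, φ, T, hT, hX⟩ := h
  have : NeZero d := ⟨hd⟩
  obtain ⟨u, v, huv⟩ := exists_pair_ne (EuclideanSpace ℝ (Fin d))
  exact ⟨n, φ.toAffineMap, T, ⟨u, v, fun h => huv (φ.injective h)⟩, hT, hX⟩

/-! ### Gram matrices of equimeasurable vectors -/

section GramCone

/-- The vectors `w i` become equal after rearranging the absolute values of their coordinates:
every symmetric statistic of these absolute values is the same for all of them. -/
def Equimeasurable {κ ι : Type*} [Fintype ι] (w : κ → ι → ℝ) : Prop :=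
  ∀ i j (F : ℝ → ℕ), ∑ x, F |w i x| = ∑ x, F |w j x|

/-- `K` is the Gram matrix of equimeasurable vectors. -/
def IsGram {κ : Type*} (K : κ → κ → ℝ) : Prop :=
  ∃ (ι : Type) (_ : Fintype ι) (w : κ → ι → ℝ), Equimeasurable w ∧
    ∀ i j, ∑ x, w i x * w j x = K i j

variable {κ : Type*}

lemma IsGram.symm {K : κ → κ → ℝ} (h : IsGram K) (i j : κ) : K i j = K j i := by
  obtain ⟨ι, _, w, -, hK⟩ := h
  rw [← hK, ← hK]
  exact Finset.sum_congr rfl fun x _ => mul_comm _ _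

lemma isGram_zero : IsGram (fun _ _ : κ => (0 : ℝ)) :=
  ⟨Empty, inferInstance, fun _ => Empty.elim, fun _ _ _ => by simp, fun _ _ => by simp⟩

lemma IsGram.add {K L : κ → κ → ℝ} (hK : IsGram K) (hL : IsGram L) :
    IsGram fun i j => K i j + L i j := by
  obtain ⟨ι, _, w, hw, hK⟩ := hK
  obtain ⟨ι', _, w', hw', hL⟩ := hL
  refine ⟨ι ⊕ ι', inferInstance, fun i => Sum.elim (w i) (w' i), fun i j F => ?_, fun i j => ?_⟩
  · simp only [Fintype.sum_sum_type, Sum.elim_inl, Sum.elim_inr, hw i j F, hw' i j F]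
  · simp only [Fintype.sum_sum_type, Sum.elim_inl, Sum.elim_inr, hK, hL]

lemma IsGram.const_mul {K : κ → κ → ℝ} (hK : IsGram K) {c : ℝ} (hc : 0 ≤ c) :
    IsGram fun i j => c * K i j := by
  obtain ⟨ι, _, w, hw, hK⟩ := hK
  refine ⟨ι, inferInstance, fun i x => √c * w i x, fun i j F => ?_, fun i j => ?_⟩
  · simp only [abs_mul]
    exact hw i j fun y => F (|√c| * y)
  · beta_reduce
    rw [← hK, Finset.mul_sum]
    refine Finset.sum_congr rfl fun x _ => ?_
    rw [mul_mul_mul_comm, Real.mul_self_sqrt hc]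

lemma isGram_sum {α : Type*} (s : Finset α) {K : α → κ → κ → ℝ} (h : ∀ a ∈ s, IsGram (K a)) :
    IsGram fun i j => ∑ a ∈ s, K a i j := by
  classical
  induction s using Finset.induction_on with
  | empty => simpa using isGram_zero
  | insert a s ha ih =>
    simp only [Finset.sum_insert ha]
    exact (h a (Finset.mem_insert_self a s)).add
      (ih fun b hb => h b (Finset.mem_insert_of_mem hb))

lemma equimeasurable_single {ι : Type*} [Fintype ι] [DecidableEq ι] (f : κ → ι) {s : κ → ℝ} {c : ℝ}
    (hs : ∀ i, |s i| = c) : Equimeasurable fun i => Pi.single (f i) (s i) := by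
  have key : ∀ i (F : ℝ → ℕ), ∑ x, F |(Pi.single (f i) (s i) : ι → ℝ) x| =
      F c + (Fintype.card ι - 1) * F 0 := by
    intro i F
    rw [← Finset.add_sum_erase _ _ (Finset.mem_univ (f i)), Pi.single_eq_same, hs]
    congr 1
    rw [Finset.sum_congr rfl (g := fun _ => F 0)]
    · simp [Finset.card_erase_of_mem]
    · intro x hx
      rw [Pi.single_eq_of_ne (Finset.ne_of_mem_erase hx), abs_zero]
  intro i j F
  rw [key, key]

variable [Fintype κ] [DecidableEq κ]

lemma isGram_one : IsGram fun i j : κ => if i = j then (1 : ℝ) else 0 := by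
  refine ⟨Fin (Fintype.card κ), inferInstance, fun i => Pi.single (Fintype.equivFin κ i) 1,
    equimeasurable_single (fun i => Fintype.equivFin κ i) (c := 1) (fun _ => abs_one),
    fun i j => ?_⟩
  rw [Finset.sum_eq_single (Fintype.equivFin κ i)]
  · simp [Pi.single_apply]
  · intro x _ hx
    simp [hx]
  · simp

/-- One pair of opposite off-diagonal entries: all vectors are multiples of different unit vectors,
except that the vectors with indices `p` and `q` are parallel. -/
lemma isGram_pair {p q : κ} (hpq : p ≠ q) (r : ℝ) :
    IsGram fun i j : κ => if i = j then |r| else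
      (if p = i ∧ q = j then r else 0) + (if p = j ∧ q = i then r else 0) := by
  set e := Fintype.equivFin κ
  set t : ℝ := if 0 ≤ r then √|r| else -√|r| with ht
  have ht2 : t * √|r| = r := by
    have := Real.mul_self_sqrt (abs_nonneg r)
    rw [ht]
    split_ifs with h
    · rw [this, abs_of_nonneg h]
    · rw [neg_mul, this, abs_of_neg (not_le.1 h), neg_neg]
  have ht2' : √|r| * t = r := mul_comm t _ ▸ ht2
  have htt : t * t = |r| := by
    have := Real.mul_self_sqrt (abs_nonneg r)
    rw [ht]
    split_ifs with h
    · exact this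
    · rw [neg_mul_neg, this]
  have hta : |t| = √|r| := by
    rw [ht]
    split_ifs with h
    · exact abs_of_nonneg (Real.sqrt_nonneg _)
    · rw [abs_neg, abs_of_nonneg (Real.sqrt_nonneg _)]
  refine ⟨Fin (Fintype.card κ), inferInstance,
    fun i => Pi.single (e (if i = q then p else i)) (if i = q then t else √|r|),
    equimeasurable_single (fun i => e (if i = q then p else i)) (c := √|r|) (fun i => ?_),
    fun i j => ?_⟩
  · split_ifs
    · exact hta
    · exact abs_of_nonneg (Real.sqrt_nonneg _)
  · rw [Finset.sum_eq_single (e (if i = q then p else i))]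
    · have hs := Real.mul_self_sqrt (abs_nonneg r)
      simp only [Pi.single_eq_same, Pi.single_apply, e.injective.eq_iff]
      by_cases hi : i = q <;> by_cases hj : j = q
      · subst hi hj
        simp [htt]
      · subst hi
        by_cases hpj : p = j
        · subst hpj
          simp [hj, ht2, Ne.symm hpq]
        · simp [hj, hpj, Ne.symm hj, hpq]
      · subst hj
        by_cases hpi : p = i
        · subst hpi
          simp [hi, ht2']
        · simp [hi, hpi, Ne.symm hpi, hpq]
      · by_cases hij : i = j
        · subst hij
          simp [hi, hs]
        · simp [hi, hj, hij, Ne.symm hi, Ne.symm hj]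
    · intro x _ hx
      simp [hx]
    · simp

/-- Symmetric, diagonally dominant matrices with constant diagonal are Gram matrices of
equimeasurable vectors. -/
lemma isGram_of_diagonally_dominant {K : κ → κ → ℝ} {D : ℝ} (hsymm : ∀ i j, K i j = K j i)
    (hdiag : ∀ i, K i i = D) (hD : ∑ a ∈ (Finset.univ : Finset κ).offDiag, |K a.1 a.2 / 2| ≤ D) :
    IsGram K := by
  have h1 : IsGram fun i j : κ =>
      ∑ a ∈ (Finset.univ : Finset κ).offDiag, (if i = j then |K a.1 a.2 / 2| else
        (if a.1 = i ∧ a.2 = j then K a.1 a.2 / 2 else 0) +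
          (if a.1 = j ∧ a.2 = i then K a.1 a.2 / 2 else 0)) :=
    isGram_sum _ fun a ha => isGram_pair (Finset.mem_offDiag.1 ha).2.2 _
  have h2 := h1.add (isGram_one.const_mul (sub_nonneg.2 hD))
  convert h2 using 3 with i j
  by_cases hij : i = j
  · subst hij
    simp [hdiag]
  · have hs : ∀ i j : κ, i ≠ j → ∑ a ∈ (Finset.univ : Finset κ).offDiag,
        (if a.1 = i ∧ a.2 = j then K a.1 a.2 / 2 else 0) = K i j / 2 := by
      intro i j hij
      rw [Finset.sum_eq_single (i, j)]
      · simp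
      · rintro ⟨a, b⟩ _ hab
        simp only [Prod.mk.injEq, ne_eq] at hab
        simp [hab]
      · simp [hij]
    simp only [hij, if_false, Finset.sum_add_distrib, mul_zero, add_zero, hs i j hij,
      hs j i (Ne.symm hij), hsymm j i]
    ring

end GramCone

/-! ### Discretized inverse square roots -/

section Profile

/-- Partial sums of the harmonic series. -/
noncomputable def harm (n : ℕ) : ℝ := ∑ q ∈ Finset.range n, 1 / ((q : ℝ) + 1)

lemma tendsto_harm : Tendsto harm atTop atTop := Real.tendsto_sum_range_one_div_nat_succ_atTop

/-- The sequence of the values `(q + 1) ^ (-1/2)`, `q < Q`, each repeated `b` times, followed by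
zeros. It approximates `z ↦ √b * z ^ (-1/2)`. -/
noncomputable def profile (b Q z : ℕ) : ℝ :=
  if z < b * Q then (√((z / b : ℕ) + 1 : ℝ))⁻¹ else 0

lemma profile_nonneg (b Q z : ℕ) : 0 ≤ profile b Q z := by
  unfold profile
  split_ifs <;> positivity

lemma sum_range_mul_div {R : Type*} [CommSemiring R] (f : ℕ → R) (b Q : ℕ) :
    ∑ z ∈ Finset.range (b * Q), f (z / b) = b * ∑ q ∈ Finset.range Q, f q := by
  induction Q with
  | zero => simp
  | succ Q ih =>
    rw [Nat.mul_succ, Finset.sum_range_add, ih, Finset.sum_range_succ, mul_add]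
    congr 1
    rw [Finset.sum_congr rfl (g := fun _ => f Q)]
    · simp
    · intro x hx
      have hx := Finset.mem_range.1 hx
      rw [Nat.mul_add_div (by omega), Nat.div_eq_of_lt hx, add_zero]

lemma sum_comp_profile {R : Type*} [CommSemiring R] (F : ℝ → R) {b Q N : ℕ} (h : b * Q ≤ N) :
    ∑ z ∈ Finset.range N, F (profile b Q z) + (b * Q : ℕ) * F 0 =
      b * ∑ q ∈ Finset.range Q, F (√((q : ℝ) + 1))⁻¹ + N * F 0 := by
  obtain ⟨r, rfl⟩ := Nat.exists_eq_add_of_le h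
  rw [Finset.sum_range_add, ← sum_range_mul_div,
    Finset.sum_congr rfl (g := fun z => F (√((z / b : ℕ) + 1 : ℝ))⁻¹),
    Finset.sum_congr rfl (s₁ := Finset.range r) (g := fun _ => F 0)]
  · simp
    ring
  · intro x _
    simp [profile]
  · intro x hx
    simp [profile, Finset.mem_range.1 hx]

lemma sum_profile_sq {b Q N : ℕ} (h : b * Q ≤ N) :
    ∑ z ∈ Finset.range N, profile b Q z * profile b Q z = b * harm Q := by
  have := sum_comp_profile (fun x : ℝ => x * x) h
  simp only [mul_zero, add_zero] at this
  rw [this, harm]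
  congr 1
  refine Finset.sum_congr rfl fun q _ => ?_
  rw [← mul_inv, Real.mul_self_sqrt (by positivity), one_div]

lemma tendsto_succ_div_div_succ {b : ℕ} (hb : 0 < b) :
    Tendsto (fun z : ℕ => ((z : ℝ) + 1) / ((z / b : ℕ) + 1 : ℝ)) atTop (𝓝 b) := by
  have hlim : Tendsto (fun z : ℕ => (b : ℝ) * b * (1 / ((z : ℝ) + 1))) atTop (𝓝 0) := by
    simpa using tendsto_one_div_add_atTop_nhds_zero_nat.const_mul ((b : ℝ) * b)
  rw [tendsto_iff_dist_tendsto_zero]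
  refine squeeze_zero (fun _ => dist_nonneg) (fun z => ?_) hlim
  have h1 : (z : ℝ) = b * (z / b : ℕ) + (z % b : ℕ) := by exact_mod_cast (Nat.div_add_mod z b).symm
  have h2 : ((z % b : ℕ) : ℝ) + 1 ≤ b := by exact_mod_cast Nat.mod_lt z hb
  have h3 : (0 : ℝ) ≤ (z % b : ℕ) := Nat.cast_nonneg _
  have h4 : (0 : ℝ) ≤ (z / b : ℕ) := Nat.cast_nonneg _
  set u : ℝ := ((z / b : ℕ) : ℝ)
  set r : ℝ := ((z % b : ℕ) : ℝ)
  have hb' : (0 : ℝ) < b := Nat.cast_pos.2 hb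
  have hu : (0 : ℝ) < u + 1 := by linarith
  have hz : (0 : ℝ) < (z : ℝ) + 1 := by positivity
  rw [Real.dist_eq, div_sub' hu.ne', abs_div, abs_of_pos hu, mul_one_div, div_le_div_iff₀ hu hz]
  have h5 : |(z : ℝ) + 1 - (u + 1) * b| ≤ b := by
    rw [h1, abs_le]
    constructor <;> nlinarith
  have h6 : (z : ℝ) + 1 ≤ b * (u + 1) := by rw [h1]; nlinarith
  calc _ ≤ (b : ℝ) * (b * (u + 1)) := mul_le_mul h5 h6 hz.le hb'.le
    _ = _ := by ring

lemma tendsto_harm_mul_div_harm {m : ℕ} (hm : 0 < m) :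
    Tendsto (fun Q => harm (m * Q) / harm Q) atTop (𝓝 1) := by
  have hupper : Tendsto (fun Q => 1 + (m : ℝ) / harm Q) atTop (𝓝 1) := by
    simpa using tendsto_const_nhds.add (tendsto_harm.const_div_atTop (m : ℝ))
  refine tendsto_of_tendsto_of_tendsto_of_le_of_le' tendsto_const_nhds hupper ?_ ?_
  all_goals
    filter_upwards [tendsto_harm.eventually_gt_atTop 0, eventually_gt_atTop 0] with Q hQ hQ0
  · rw [le_div_iff₀ hQ, one_mul]
    refine Finset.sum_le_sum_of_subset_of_nonneg ?_ fun _ _ _ => by positivity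
    exact Finset.range_mono (Nat.le_mul_of_pos_left Q hm)
  · rw [div_le_iff₀ hQ, add_mul, one_mul, div_mul_cancel₀ _ hQ.ne']
    obtain ⟨k, rfl⟩ : ∃ k, m = k + 1 := ⟨m - 1, by omega⟩
    have hQ' : (0 : ℝ) < Q := Nat.cast_pos.2 hQ0
    rw [harm, harm, add_mul, one_mul, add_comm (k * Q), Finset.sum_range_add]
    gcongr
    calc _ ≤ ∑ _x ∈ Finset.range (k * Q), 1 / (Q : ℝ) := by
          refine Finset.sum_le_sum fun x _ => one_div_le_one_div_of_le hQ' ?_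
          push_cast
          linarith [(Nat.cast_nonneg x : (0 : ℝ) ≤ x)]
      _ = k := by simp; field_simp
      _ ≤ _ := by push_cast; linarith

/-- The correlation of two profiles, relative to the harmonic sum, converges to the geometric mean
of the multiplicities, as for the functions `√b * z ^ (-1/2)` that they approximate. -/
lemma tendsto_sum_profile_mul (b b' B : ℕ) (hb : b ≤ B) :
    Tendsto (fun Q => (∑ z ∈ Finset.range (B * Q), profile b Q z * profile b' Q z) / harm Q) atTop
      (𝓝 (√b * √b')) := by
  rcases Nat.eq_zero_or_pos b with rfl | hb0
  · simp [profile]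
  rcases Nat.eq_zero_or_pos b' with rfl | hb0'
  · simp [profile]
  set f : ℕ → ℝ := fun z => (√((z / b : ℕ) + 1 : ℝ))⁻¹ * (√((z / b' : ℕ) + 1 : ℝ))⁻¹ with hf
  set m := min b b' with hm
  have hm0 : 0 < m := lt_min hb0 hb0'
  have hmQ : ∀ Q, m * Q = min (b * Q) (b' * Q) := fun Q => min_mul_of_nonneg b b' (Nat.zero_le Q)
  have hsum : ∀ Q, ∑ z ∈ Finset.range (B * Q), profile b Q z * profile b' Q z =
      ∑ z ∈ Finset.range (m * Q), f z := by
    intro Q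
    symm
    rw [Finset.sum_subset_zero_on_sdiff (g := fun z => profile b Q z * profile b' Q z)]
    · exact Finset.range_mono (Nat.mul_le_mul_right Q ((min_le_left _ _).trans hb))
    · intro z hz
      simp only [Finset.mem_sdiff, Finset.mem_range, not_lt, hmQ] at hz
      rcases min_le_iff.1 hz.2 with h | h
      · simp [profile, not_lt.2 h]
      · simp [profile, not_lt.2 h]
    · intro z hz
      simp only [Finset.mem_range, hmQ, lt_min_iff] at hz
      simp [profile, hz, hf]
  have hratio : Tendsto (fun z : ℕ => f z / (1 / ((z : ℝ) + 1))) atTop (𝓝 (√b * √b')) := by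
    have h1 := (tendsto_succ_div_div_succ hb0).sqrt.mul (tendsto_succ_div_div_succ hb0').sqrt
    refine h1.congr fun z => ?_
    have hz : (0 : ℝ) ≤ (z : ℝ) + 1 := by positivity
    rw [Real.sqrt_div hz, Real.sqrt_div hz, hf]
    have := Real.mul_self_sqrt hz
    simp only [one_div, div_inv_eq_mul]
    rw [div_mul_div_comm, this, div_eq_inv_mul, mul_inv]
  have hlittle : (fun z : ℕ => f z - √b * √b' * (1 / ((z : ℝ) + 1))) =o[atTop]
      fun z : ℕ => 1 / ((z : ℝ) + 1) := by
    refine (Asymptotics.isLittleO_iff_tendsto fun z hz => ?_).2 ?_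
    · exact absurd hz (by positivity)
    · have := hratio.sub_const (√b * √b')
      rw [sub_self] at this
      refine this.congr fun z => ?_
      have : (1 / ((z : ℝ) + 1)) ≠ 0 := by positivity
      rw [sub_div, mul_div_cancel_right₀ _ this]
  have h2 := (hlittle.sum_range (fun z => by simp only [Pi.zero_apply]; positivity)
    tendsto_harm).tendsto_div_nhds_zero
  have h3 : Tendsto (fun n => (∑ z ∈ Finset.range n, f z) / harm n) atTop (𝓝 (√b * √b')) := by
    have h4 := h2.add_const (√b * √b')
    rw [zero_add] at h4
    refine h4.congr' ?_
    filter_upwards [tendsto_harm.eventually_gt_atTop 0] with n hn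
    rw [Finset.sum_sub_distrib, ← Finset.mul_sum, ← harm, sub_div, mul_div_cancel_right₀ _ hn.ne',
      sub_add_cancel]
  have h5 : Tendsto (fun Q => m * Q) atTop atTop := tendsto_id.const_mul_atTop' hm0
  have h6 := (h3.comp h5).mul (tendsto_harm_mul_div_harm hm0)
  rw [mul_one] at h6
  refine h6.congr' ?_
  filter_upwards [(tendsto_harm.comp h5).eventually_gt_atTop 0] with Q hQ
  simp only [Function.comp_apply] at hQ ⊢
  rw [hsum, div_mul_div_cancel₀ hQ.ne']

end Profile

/-! ### Approximation of Gram matrices -/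

section Approximation

variable {κ ρ : Type*} [Fintype ρ]

/-- Signed profiles, one block of coordinates for each `k`, are equimeasurable as soon as the total
multiplicity `∑ k, b i k` is the same for all `i`. -/
lemma isGram_profile {B : ℕ} (b : κ → ρ → ℕ) (hb : ∀ i, ∑ k, b i k = B) {ε : κ → ρ → ℝ}
    (hε : ∀ i k, |ε i k| = 1) (Q : ℕ) :
    IsGram fun i j => ∑ k, ε i k * ε j k *
      ∑ z ∈ Finset.range (B * Q), profile (b i k) Q z * profile (b j k) Q z := by
  have hle : ∀ i k, b i k * Q ≤ B * Q := fun i k => by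
    rw [← hb i]
    exact Nat.mul_le_mul_right Q (Finset.single_le_sum (f := b i) (fun _ _ => Nat.zero_le _)
      (Finset.mem_univ k))
  refine ⟨Fin (Fintype.card ρ) × Fin (B * Q), inferInstance,
    fun i x => ε i ((Fintype.equivFin ρ).symm x.1) *
      profile (b i ((Fintype.equivFin ρ).symm x.1)) Q x.2, ?_, fun i j => ?_⟩
  · have key : ∀ i (F : ℝ → ℕ), (∑ x : Fin (Fintype.card ρ) × Fin (B * Q),
        F |ε i ((Fintype.equivFin ρ).symm x.1) *
          profile (b i ((Fintype.equivFin ρ).symm x.1)) Q x.2|) + B * Q * F 0 =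
        B * (∑ q ∈ Finset.range Q, F (√((q : ℝ) + 1))⁻¹) +
          Fintype.card ρ * B * Q * F 0 := by
      intro i F
      have h1 : ∀ k, ∑ z ∈ Finset.range (B * Q), F (profile (b i k) Q z) + b i k * Q * F 0 =
          b i k * (∑ q ∈ Finset.range Q, F (√((q : ℝ) + 1))⁻¹) + B * Q * F 0 := fun k => by
        simpa using sum_comp_profile F (hle i k)
      have h2 := Finset.sum_congr rfl fun k (_ : k ∈ Finset.univ) => h1 k
      simp only [Finset.sum_add_distrib, ← Finset.sum_mul, hb, Finset.sum_const, Finset.card_univ,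
        smul_eq_mul] at h2
      rw [← h2]
      congr 1
      simp only [abs_mul, hε, one_mul, abs_of_nonneg (profile_nonneg _ _ _)]
      rw [Fintype.sum_prod_type,
        Equiv.sum_comp (Fintype.equivFin ρ).symm fun k =>
          ∑ z : Fin (B * Q), F (profile (b i k) Q z)]
      exact Finset.sum_congr rfl fun k _ =>
        Fin.sum_univ_eq_sum_range (fun z => F (profile (b i k) Q z)) _
    intro i j F
    exact Nat.add_right_cancel ((key i F).trans (key j F).symm)
  · rw [Fintype.sum_prod_type,
      Equiv.sum_comp (Fintype.equivFin ρ).symm fun k => ∑ z : Fin (B * Q),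
        ε i k * profile (b i k) Q z * (ε j k * profile (b j k) Q z)]
    refine Finset.sum_congr rfl fun k _ => ?_
    rw [Finset.mul_sum, ← Fin.sum_univ_eq_sum_range
      fun z => ε i k * ε j k * (profile (b i k) Q z * profile (b j k) Q z)]
    exact Finset.sum_congr rfl fun z _ => mul_mul_mul_comm _ _ _ _

/-- Gram matrices of signed profiles realize, up to a small error off the diagonal, matrices built
from square roots of multiplicities. -/
lemma exists_isGram_near_sqrt [Finite κ] {B : ℕ} (hB : 0 < B) (b : κ → ρ → ℕ)
    (hb : ∀ i, ∑ k, b i k = B) {ε : κ → ρ → ℝ} (hε : ∀ i k, |ε i k| = 1) {D : ℝ} (hD : 0 ≤ D)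
    {η : ℝ} (hη : 0 < η) :
    ∃ C : κ → κ → ℝ, IsGram C ∧ (∀ i, C i i = D) ∧
      ∀ i j, |C i j - D / B * ∑ k, ε i k * ε j k * (√(b i k) * √(b j k))| < η := by
  have hle : ∀ i k, b i k ≤ B := fun i k => by
    rw [← hb i]
    exact Finset.single_le_sum (f := b i) (fun _ _ => Nat.zero_le _) (Finset.mem_univ k)
  set S : ℕ → κ → κ → ℝ := fun Q i j => ∑ k, ε i k * ε j k *
      ∑ z ∈ Finset.range (B * Q), profile (b i k) Q z * profile (b j k) Q z with hS
  have hlim : ∀ i j, Tendsto (fun Q => D / (B * harm Q) * S Q i j) atTop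
      (𝓝 (D / B * ∑ k, ε i k * ε j k * (√(b i k) * √(b j k)))) := by
    intro i j
    have h1 : Tendsto (fun Q => ∑ k, ε i k * ε j k *
        ((∑ z ∈ Finset.range (B * Q), profile (b i k) Q z * profile (b j k) Q z) / harm Q)) atTop
        (𝓝 (∑ k, ε i k * ε j k * (√(b i k) * √(b j k)))) :=
      tendsto_finsetSum _ fun k _ => (tendsto_sum_profile_mul _ _ B (hle i k)).const_mul _
    refine (h1.const_mul (D / B)).congr fun Q => ?_
    simp only [← mul_div_assoc, ← Finset.sum_div, hS]
    rw [div_mul_eq_mul_div, div_mul_eq_mul_div, div_div]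
  have hev : ∀ᶠ Q in atTop, ∀ i j, |D / (B * harm Q) * S Q i j -
      D / B * ∑ k, ε i k * ε j k * (√(b i k) * √(b j k))| < η :=
    eventually_all.2 fun i => eventually_all.2 fun j => by
      simpa only [Real.dist_eq] using (hlim i j).eventually (Metric.ball_mem_nhds _ hη)
  obtain ⟨Q, hQ, hQ0⟩ := (hev.and (tendsto_harm.eventually_gt_atTop 0)).exists
  have hB' : (0 : ℝ) < B := Nat.cast_pos.2 hB
  refine ⟨_, (isGram_profile b hb hε Q).const_mul (div_nonneg hD (mul_pos hB' hQ0).le),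
    fun i => ?_, hQ⟩
  have h1 : ∀ k, ε i k * ε i k = 1 := fun k => by
    rw [← abs_mul_abs_self, hε, one_mul]
  have h2 : ∀ k, b i k * Q ≤ B * Q := fun k => Nat.mul_le_mul_right Q (hle i k)
  simp only [h1, one_mul, sum_profile_sq (h2 _), ← Finset.sum_mul]
  rw [← Nat.cast_sum, hb, div_mul_cancel₀ _ (mul_pos hB' hQ0).ne']

/-- The Gram matrix of vectors of equal length is approximated, exactly on the diagonal, by Gram
matrices of equimeasurable vectors. The squares of the coordinates are rounded to fractions with
denominator `N`; a private coordinate for each vector collects the rounding errors. -/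
lemma exists_isGram_near [Fintype κ] [DecidableEq κ] (a : κ → ρ → ℝ) {D : ℝ} (hD : 0 < D)
    (ha : ∀ i, ∑ k, a i k ^ 2 = D) {η : ℝ} (hη : 0 < η) :
    ∃ C : κ → κ → ℝ, IsGram C ∧ (∀ i, C i i = D) ∧
      ∀ i j, i ≠ j → |C i j - ∑ k, a i k * a j k| < η := by
  set s : κ → ρ → ℝ := fun i k => if a i k < 0 then -1 else 1 with hs
  have hsa : ∀ i k, s i k * |a i k| = a i k := by
    intro i k
    simp only [hs]
    split_ifs with h
    · rw [abs_of_neg h]; ring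
    · rw [abs_of_nonneg (not_lt.1 h)]; ring
  have hfloor : ∀ c : ℝ, 0 ≤ c → Tendsto (fun N : ℕ => (⌊c * N⌋₊ : ℝ) / N) atTop (𝓝 c) :=
    fun c hc => (tendsto_nat_floor_mul_div_atTop hc).comp tendsto_natCast_atTop_atTop
  have hlim : ∀ i j, Tendsto (fun N : ℕ => D / (⌊D * N⌋₊ : ℝ) *
      ∑ k, s i k * s j k * (√⌊a i k ^ 2 * N⌋₊ * √⌊a j k ^ 2 * N⌋₊)) atTop
      (𝓝 (∑ k, a i k * a j k)) := by
    intro i j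
    have h1 : Tendsto (fun N : ℕ => D / ((⌊D * N⌋₊ : ℝ) / N) * ∑ k, s i k * s j k *
        (√((⌊a i k ^ 2 * N⌋₊ : ℝ) / N) * √((⌊a j k ^ 2 * N⌋₊ : ℝ) / N))) atTop
        (𝓝 (D / D * ∑ k, s i k * s j k * (√(a i k ^ 2) * √(a j k ^ 2)))) :=
      (tendsto_const_nhds.div (hfloor D hD.le) hD.ne').mul (tendsto_finsetSum _ fun k _ =>
        (((hfloor _ (sq_nonneg _)).sqrt).mul ((hfloor _ (sq_nonneg _)).sqrt)).const_mul _)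
    have h2 : D / D * ∑ k, s i k * s j k * (√(a i k ^ 2) * √(a j k ^ 2)) =
        ∑ k, a i k * a j k := by
      rw [div_self hD.ne', one_mul]
      refine Finset.sum_congr rfl fun k _ => ?_
      rw [Real.sqrt_sq_eq_abs, Real.sqrt_sq_eq_abs, mul_mul_mul_comm, hsa, hsa]
    rw [h2] at h1
    refine h1.congr' ?_
    filter_upwards [eventually_gt_atTop 0] with N hN
    have hN' : (0 : ℝ) < N := Nat.cast_pos.2 hN
    have h3 : ∀ x y : ℝ, √(x / N) * √(y / N) = √x * √y / N := by
      intro x y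
      rw [Real.sqrt_div' _ hN'.le, Real.sqrt_div' _ hN'.le, div_mul_div_comm,
        Real.mul_self_sqrt hN'.le]
    simp only [h3, ← mul_div_assoc, ← Finset.sum_div]
    rw [div_div_eq_mul_div, mul_div_right_comm D, mul_right_comm, mul_div_cancel_right₀ _ hN'.ne']
  have hev : ∀ᶠ N : ℕ in atTop, ∀ i j, |D / (⌊D * N⌋₊ : ℝ) *
      ∑ k, s i k * s j k * (√⌊a i k ^ 2 * N⌋₊ * √⌊a j k ^ 2 * N⌋₊) - ∑ k, a i k * a j k| < η / 2 :=
    eventually_all.2 fun i => eventually_all.2 fun j => by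
      simpa only [Real.dist_eq] using (hlim i j).eventually (Metric.ball_mem_nhds _ (half_pos hη))
  have hpos : ∀ᶠ N : ℕ in atTop, 1 ≤ D * N :=
    (tendsto_natCast_atTop_atTop.const_mul_atTop hD).eventually_ge_atTop 1
  obtain ⟨N, hN, hN1⟩ := (hev.and hpos).exists
  have hBpos : 0 < ⌊D * N⌋₊ := Nat.floor_pos.2 hN1
  have hle : ∀ i, ∑ k, ⌊a i k ^ 2 * N⌋₊ ≤ ⌊D * N⌋₊ := by
    intro i
    rw [Nat.le_floor_iff (by linarith), ← ha i, Finset.sum_mul, Nat.cast_sum]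
    exact Finset.sum_le_sum fun k _ => Nat.floor_le (by positivity)
  set b : κ → ρ ⊕ κ → ℕ := fun i => Sum.elim (fun k => ⌊a i k ^ 2 * N⌋₊)
    (fun l => if l = i then ⌊D * N⌋₊ - ∑ k, ⌊a i k ^ 2 * N⌋₊ else 0) with hb
  set ε : κ → ρ ⊕ κ → ℝ := fun i => Sum.elim (s i) fun _ => 1 with hε
  obtain ⟨C, hC, hCd, hCo⟩ := exists_isGram_near_sqrt hBpos b (fun i => by
    simp only [hb, Fintype.sum_sum_type, Sum.elim_inl, Sum.elim_inr, Finset.sum_ite_eq',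
      Finset.mem_univ, if_true]
    exact Nat.add_sub_cancel' (hle i)) (ε := ε) (fun i k => by
      rcases k with k | l
      · simp only [hε, hs, Sum.elim_inl]
        split_ifs <;> simp
      · simp [hε]) hD.le (half_pos hη)
  refine ⟨C, hC, hCd, fun i j hij => ?_⟩
  have h1 := hCo i j
  have h2 : ∀ l, (√((b i (Sum.inr l) : ℕ) : ℝ) * √((b j (Sum.inr l) : ℕ) : ℝ)) = 0 := by
    intro l
    by_cases hl : l = i
    · have : l ≠ j := fun h => hij (hl.symm.trans h)
      simp [hb, this]
    · simp [hb, hl]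
  simp only [Fintype.sum_sum_type, h2, mul_zero, Finset.sum_const_zero, add_zero] at h1
  simp only [hb, hε, Sum.elim_inl] at h1
  have h3 := hN i j
  have h4 := abs_sub_lt_iff.1 h1
  have h5 := abs_sub_lt_iff.1 h3
  exact abs_sub_lt_iff.2 ⟨by linarith, by linarith⟩

end Approximation

/-! ### Gram matrices of linearly independent vectors -/

section Gram

variable {κ : Type*} [Fintype κ] [DecidableEq κ]

open scoped MatrixOrder in
/-- The Gram matrix `K` of linearly independent vectors of equal length is the Gram matrix of
equimeasurable vectors: for small `δ > 0` the matrix `K - δ I` is still a Gram matrix, hence close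
to the Gram matrix of equimeasurable vectors, and the difference is diagonally dominant. -/
lemma isGram_of_linearIndependent {V : Type*} [NormedAddCommGroup V] [InnerProductSpace ℝ V]
    {q : κ → V} (hq : LinearIndependent ℝ q) {D₀ : ℝ} (hD₀ : 0 < D₀)
    (hqD : ∀ i, inner ℝ (q i) (q i) = D₀) : IsGram fun i j => inner ℝ (q i) (q j) := by
  obtain ⟨c, hc, hanti⟩ := ((Fintype.linearCombination ℝ q).comp
    (WithLp.linearEquiv 2 ℝ (κ → ℝ)).toLinearMap).exists_antilipschitzWith (by
      rw [LinearMap.ker_eq_bot']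
      intro x hx
      ext i
      exact Fintype.linearIndependent_iff.1 hq x.ofLp
        (by simpa [Fintype.linearCombination_apply] using hx) i)
  have hbound : ∀ x : κ → ℝ, ∑ i, x i ^ 2 ≤ c ^ 2 * ‖∑ i, x i • q i‖ ^ 2 := by
    intro x
    have h1 := hanti.le_mul_dist (WithLp.toLp 2 x) 0
    rw [map_zero, dist_zero_right, dist_zero_right] at h1
    have h2 := pow_le_pow_left₀ (norm_nonneg _) h1 2
    rw [EuclideanSpace.norm_sq_eq, mul_pow] at h2
    simpa [Fintype.linearCombination_apply] using h2
  have hc' : (0 : ℝ) < c := hc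
  set δ : ℝ := min (1 / (c : ℝ) ^ 2) (D₀ / 2) with hδ
  have hδ0 : 0 < δ := lt_min (by positivity) (by positivity)
  have hδ1 : δ ≤ 1 / (c : ℝ) ^ 2 := min_le_left _ _
  have hδ2 : δ ≤ D₀ / 2 := min_le_right _ _
  set P : Matrix κ κ ℝ := Matrix.of fun i j => inner ℝ (q i) (q j) - if i = j then δ else 0 with hP
  have hPpos : P.PosSemidef := by
    refine Matrix.PosSemidef.of_dotProduct_mulVec_nonneg ?_ fun x => ?_
    · ext i j
      simp [hP, real_inner_comm, eq_comm]
    · have h1 : star x ⬝ᵥ P.mulVec x = ‖∑ i, x i • q i‖ ^ 2 - δ * ∑ i, x i ^ 2 := by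
        rw [← real_inner_self_eq_norm_sq, sum_inner]
        simp only [inner_sum, inner_smul_left, inner_smul_right, dotProduct, Matrix.mulVec, hP,
          Matrix.of_apply, sub_mul, Finset.sum_sub_distrib, mul_sub, Finset.mul_sum]
        congr 1
        · refine Finset.sum_congr rfl fun i _ => Finset.sum_congr rfl fun j _ => ?_
          simp
          ring
        · refine Finset.sum_congr rfl fun i _ => ?_
          simp
          ring
      rw [h1, sub_nonneg]
      calc δ * ∑ i, x i ^ 2 ≤ 1 / (c : ℝ) ^ 2 * (c ^ 2 * ‖∑ i, x i • q i‖ ^ 2) :=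
            mul_le_mul hδ1 (hbound x) (Finset.sum_nonneg fun _ _ => sq_nonneg _) (by positivity)
        _ = _ := by field_simp
  obtain ⟨A, hA⟩ := CStarAlgebra.nonneg_iff_eq_star_mul_self.mp hPpos.nonneg
  have hPA : ∀ i j, P i j = ∑ k, A k i * A k j := by
    intro i j
    rw [hA, Matrix.mul_apply]
    simp [Matrix.star_apply]
  set N : ℝ := ((Finset.univ : Finset κ).offDiag.card : ℝ) with hN
  have hN0 : 0 ≤ N := Nat.cast_nonneg _
  obtain ⟨C, hC, hCd, hCo⟩ := exists_isGram_near (fun i k => A k i) (D := D₀ - δ) (by linarith)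
    (fun i => by
      have := hPA i i
      simp only [hP, Matrix.of_apply, hqD, if_true] at this
      rw [this]
      exact Finset.sum_congr rfl fun k _ => sq _) (η := δ / (N + 1)) (by positivity)
  have hR : IsGram fun i j => inner ℝ (q i) (q j) - C i j := by
    refine isGram_of_diagonally_dominant (D := δ) (fun i j => ?_) (fun i => ?_) ?_
    · rw [real_inner_comm, hC.symm]
    · rw [hqD, hCd]; ring
    · calc _ ≤ ∑ _a ∈ (Finset.univ : Finset κ).offDiag, δ / (N + 1) := by
            refine Finset.sum_le_sum fun a ha => ?_
            have hne := (Finset.mem_offDiag.1 ha).2.2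
            have h1 := hCo a.1 a.2 hne
            rw [← hPA, abs_sub_comm] at h1
            simp only [hP, Matrix.of_apply, hne, if_false, sub_zero] at h1
            rw [abs_div, abs_two]
            have := abs_nonneg (inner ℝ (q a.1) (q a.2) - C a.1 a.2)
            linarith
        _ = N * (δ / (N + 1)) := by rw [Finset.sum_const, nsmul_eq_mul]
        _ ≤ δ := by
            rw [mul_div_assoc', div_le_iff₀ (by positivity)]
            nlinarith
  have := hC.add hR
  simpa using this

end Gram

/-! ### Simplices in transitive sets -/

/-- The signed rearrangements of a vector form a transitive set. -/
lemma isTransitiveSet_signedRearrangements {m : ℕ} (v : Fin m → ℝ) :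
    IsTransitiveSet {u : EuclideanSpace ℝ (Fin m) |
      ∀ F : ℝ → ℕ, ∑ x, F |u x| = ∑ x, F |v x|} := by
  classical
  set T : Set (EuclideanSpace ℝ (Fin m)) :=
    {u | ∀ F : ℝ → ℕ, ∑ x, F |u x| = ∑ x, F |v x|} with hT
  refine ⟨?_, ?_⟩
  · have hfin : (Set.univ.pi fun _ : Fin m => {t : ℝ | ∃ y, t = |v y| ∨ t = -|v y|}).Finite := by
      refine Set.Finite.pi fun _ => ?_
      refine ((Set.finite_range fun y => |v y|).union
        (Set.finite_range fun y => -|v y|)).subset ?_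
      rintro t ⟨y, h | h⟩
      · exact Or.inl ⟨y, h.symm⟩
      · exact Or.inr ⟨y, h.symm⟩
    refine Set.Finite.subset (hfin.preimage (f := fun u : EuclideanSpace ℝ (Fin m) => u.ofLp)
      (WithLp.ofLp_injective 2).injOn) fun u hu => ?_
    simp only [Set.mem_preimage, Set.mem_pi, Set.mem_univ, forall_const, Set.mem_ofPred_eq]
    intro x
    -- The statistic counting the coordinates of absolute value `|u x|` shows that `v` has one.
    have h1 := hu fun t => if t = |u x| then 1 else 0
    have h2 : ∑ y, (if |v y| = |u x| then 1 else 0) ≠ 0 := by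
      rw [← h1]
      refine (Finset.sum_pos' (fun _ _ => Nat.zero_le _) ⟨x, Finset.mem_univ x, ?_⟩).ne'
      simp
    obtain ⟨y, -, hy⟩ := Finset.exists_ne_zero_of_sum_ne_zero h2
    have hy' : |v y| = |u x| := by
      by_contra h
      simp [h] at hy
    exact ⟨y, by rw [hy']; exact eq_or_eq_neg_of_abs_eq rfl⟩
  · refine ⟨{ carrier := {g | g '' T = T}
              mul_mem' := ?_
              one_mem' := ?_
              inv_mem' := ?_ }, fun g hg => hg, fun u hu u' hu' => ?_⟩
    · intro g g' hg hg'
      simp only [Set.mem_ofPred_eq] at hg hg' ⊢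
      rw [IsometryEquiv.coe_mul, Set.image_comp, hg', hg]
    · simp
    · intro g hg
      simp only [Set.mem_ofPred_eq] at hg ⊢
      conv_lhs => rw [← hg]
      rw [← Set.image_comp, ← IsometryEquiv.coe_mul, inv_mul_cancel]
      simp
    · -- A permutation matching absolute values, followed by sign changes, moves `u` to `u'`.
      have hcard : ∀ c : ℝ, Nonempty ({x // |u x| = c} ≃ {x // |u' x| = c}) := by
        intro c
        refine ⟨Fintype.equivOfCardEq ?_⟩
        have h1 := (hu fun t => if t = c then 1 else 0).trans
          (hu' fun t => if t = c then 1 else 0).symm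
        simpa [Fintype.card_subtype] using h1
      set e : Equiv.Perm (Fin m) := Equiv.ofFiberEquiv
        (f := fun x => |u x|) (g := fun x => |u' x|) fun c => (hcard c).some with he
      have heu : ∀ x, |u' (e x)| = |u x| := fun x =>
        Equiv.ofFiberEquiv_map (f := fun x => |u x|) (g := fun x => |u' x|) _ x
      set s : Fin m → (ℝ ≃ₗᵢ[ℝ] ℝ) := fun y =>
        if u (e.symm y) = u' y then LinearIsometryEquiv.refl ℝ ℝ else LinearIsometryEquiv.neg ℝ
        with hs
      set g : EuclideanSpace ℝ (Fin m) ≃ₗᵢ[ℝ] EuclideanSpace ℝ (Fin m) :=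
        (LinearIsometryEquiv.piLpCongrLeft 2 ℝ ℝ e).trans
          (LinearIsometryEquiv.piLpCongrRight 2 s) with hg
      have hgy : ∀ (x : EuclideanSpace ℝ (Fin m)) y, g x y = s y (x (e.symm y)) := by
        intro x y
        simp [hg, LinearIsometryEquiv.piLpCongrLeft_apply, Equiv.piCongrLeft'_apply]
      have hsabs : ∀ y t, |s y t| = |t| := by
        intro y t
        exact (s y).norm_map t
      have hgT : ∀ x, g x ∈ T ↔ x ∈ T := by
        intro x
        have : ∀ F : ℝ → ℕ, ∑ y, F |g x y| = ∑ y, F |x y| := by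
          intro F
          simp only [hgy, hsabs]
          exact Equiv.sum_comp e.symm fun y => F |x y|
        simp only [hT, Set.mem_ofPred_eq, this]
      refine ⟨g.toIsometryEquiv, ?_, ?_⟩
      · change g.toIsometryEquiv '' T = T
        ext y
        constructor
        · rintro ⟨x, hx, rfl⟩
          exact (hgT x).2 hx
        · intro hy
          refine ⟨g.symm y, (hgT _).1 ?_, ?_⟩
          · rwa [g.apply_symm_apply]
          · simp
      · ext y
        change g u y = u' y
        rw [hgy]
        simp only [hs]
        split_ifs with h
        · simpa using h
        · have h1 := heu (e.symm y)
          rw [Equiv.apply_symm_apply] at h1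
          have h2 := (abs_eq_abs.1 h1).resolve_left (Ne.symm h)
          simp [h2]

/-- Congruent simplices, the first of which is full-dimensional, are related by an affine
isometry. -/
lemma exists_affineIsometry {d n : ℕ} {p : Fin (d + 1) → EuclideanSpace ℝ (Fin d)}
    (hp : AffineIndependent ℝ p) {w : Fin (d + 1) → EuclideanSpace ℝ (Fin n)}
    (h : ∀ i j, inner ℝ (p i - p 0) (p j - p 0) = inner ℝ (w i - w 0) (w j - w 0)) :
    ∃ φ : EuclideanSpace ℝ (Fin d) →ᵃⁱ[ℝ] EuclideanSpace ℝ (Fin n), ∀ i, φ (p i) = w i := by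
  have hli := (affineIndependent_iff_linearIndependent_vsub ℝ p 0).1 hp
  have hspan := hli.span_eq_top_of_card_eq_finrank' (by simp)
  set b := Module.Basis.mk hli hspan.ge with hb
  set L : EuclideanSpace ℝ (Fin d) →ₗ[ℝ] EuclideanSpace ℝ (Fin n) :=
    b.constr ℝ fun i => w i - w 0 with hL
  have hLb : ∀ i, L (b i) = w i - w 0 := fun i => b.constr_basis ℝ _ i
  have hbi : ∀ i, b i = p i - p 0 := fun i => by simp [hb]
  have hinner : ∀ x y, inner ℝ (L x) (L y) = inner ℝ x y := by
    have : ((innerₗ (EuclideanSpace ℝ (Fin n))).compl₁₂ L L) =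
        innerₗ (EuclideanSpace ℝ (Fin d)) := by
      refine LinearMap.ext_basis b b fun i j => ?_
      simp only [LinearMap.compl₁₂_apply, innerₗ_apply_apply, hLb]
      rw [hbi, hbi]
      exact (h i j).symm
    intro x y
    simpa using congrArg (fun B => B x y) this
  set Li := L.isometryOfInner hinner with hLi
  refine ⟨(AffineIsometryEquiv.constVAdd ℝ (EuclideanSpace ℝ (Fin n))
    (w 0 - L (p 0))).toAffineIsometry.comp Li.toAffineIsometry, fun i => ?_⟩
  have hLp : L (p i) - L (p 0) = w i - w 0 := by
    rw [← map_sub]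
    by_cases hi : i = 0
    · simp [hi]
    · rw [← hbi ⟨i, hi⟩, hLb]
  have h1 : Li (p i) = L (p i) := rfl
  simp only [AffineIsometry.coe_comp, Function.comp_apply, LinearIsometry.coe_toAffineIsometry,
    AffineIsometryEquiv.coe_toAffineIsometry, AffineIsometryEquiv.coe_constVAdd, h1, vadd_eq_add]
  rw [sub_add_eq_add_sub, add_sub_assoc, hLp, add_sub_cancel]

/-- A simplex lies on a sphere. Lifting it to height `1` over its circumcenter makes its vertices
linearly independent without losing that they have equal length or changing their differences. -/
theorem isSubtransitive_of_affineIndependent {d : ℕ} {p : Fin (d + 1) → EuclideanSpace ℝ (Fin d)}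
    (hp : AffineIndependent ℝ p) : IsSubtransitive (Set.range p) := by
  set S : Affine.Simplex ℝ (EuclideanSpace ℝ (Fin d)) d := ⟨p, hp⟩ with hS
  set o := S.circumcenter with ho
  set q : Fin (d + 1) → WithLp 2 (EuclideanSpace ℝ (Fin d) × ℝ) :=
    fun i => WithLp.toLp 2 (p i - o, 1) with hq
  have hqq : ∀ i j, inner ℝ (q i) (q j) = inner ℝ (p i - o) (p j - o) + 1 := by
    intro i j
    simp [hq, WithLp.prod_inner_apply]
  have hli : LinearIndependent ℝ q := by
    rw [Fintype.linearIndependent_iff]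
    intro c hc
    have h1 : ∑ i, c i = 0 := by
      have := congrArg (fun z => (WithLp.linearEquiv 2 ℝ (EuclideanSpace ℝ (Fin d) × ℝ) z).2) hc
      simpa [hq, Prod.snd_sum] using this
    have h2 : ∑ i, c i • p i = 0 := by
      have := congrArg (fun z => (WithLp.linearEquiv 2 ℝ (EuclideanSpace ℝ (Fin d) × ℝ) z).1) hc
      simpa [hq, Prod.fst_sum, smul_sub, Finset.sum_sub_distrib, ← Finset.sum_smul, h1] using this
    have h3 := affineIndependent_iff.1 hp Finset.univ c h1 h2
    exact fun i => h3 i (Finset.mem_univ i)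
  have hD : ∀ i, inner ℝ (q i) (q i) = S.circumradius ^ 2 + 1 := by
    intro i
    rw [hqq, real_inner_self_eq_norm_sq, ← dist_eq_norm]
    congr 2
    exact S.dist_circumcenter_eq_circumradius i
  obtain ⟨ι, _, w, hw, hwK⟩ := isGram_of_linearIndependent hli (by positivity) hD
  set e := Fintype.equivFin ι
  set W : Fin (d + 1) → EuclideanSpace ℝ (Fin (Fintype.card ι)) :=
    fun i => WithLp.toLp 2 fun x => w i (e.symm x) with hW
  have hWW : ∀ i j, inner ℝ (W i) (W j) = inner ℝ (p i - o) (p j - o) + 1 := by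
    intro i j
    have h1 := hwK i j
    simp only at h1
    rw [← hqq, ← h1, ← Equiv.sum_comp e.symm]
    simp [hW, PiLp.inner_apply, mul_comm]
  obtain ⟨φ, hφ⟩ := exists_affineIsometry hp (w := W) (fun i j => by
    have h1 : ∀ k, p k - p 0 = (p k - o) - (p 0 - o) := fun k => by abel
    rw [h1, h1]
    have h2 : ∀ {V : Type} [NormedAddCommGroup V] [InnerProductSpace ℝ V] (x y z : V),
        inner ℝ (x - z) (y - z) = inner ℝ x y - inner ℝ x z - (inner ℝ z y - inner ℝ z z) := by
      intro V _ _ x y z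
      rw [inner_sub_left, inner_sub_right, inner_sub_right]
    rw [h2 (p i - o), h2 (W i), hWW, hWW, hWW, hWW]
    ring)
  refine ⟨_, φ, _, isTransitiveSet_signedRearrangements (fun x => w 0 (e.symm x)), ?_⟩
  rintro _ ⟨i, rfl⟩ F
  rw [hφ]
  have h1 := Equiv.sum_comp e.symm fun x => F |w i x|
  have h2 := Equiv.sum_comp e.symm fun x => F |w 0 x|
  exact (h1.trans (hw i 0 F)).trans h2.symm

end Subtransitive

theorem mainTheorem1 :
    (∀ d : ℕ, 2 ≤ d →
      (∀ᵐ x : Fin (d + 2) → Metric.sphere (0 : EuclideanSpace ℝ (Fin d)) 1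
          ∂(Measure.pi fun _ : Fin (d + 2) => Subtransitive.surfaceMeasure d),
        ¬ Subtransitive.IsAffinelySubtransitive
            (Set.range fun i => (x i : EuclideanSpace ℝ (Fin d)))) ∧
      (∀ᵐ x : Fin (d + 2) → Metric.sphere (0 : EuclideanSpace ℝ (Fin d)) 1
          ∂(Measure.pi fun _ : Fin (d + 2) => Subtransitive.surfaceMeasure d),
        ¬ Subtransitive.IsSubtransitive
            (Set.range fun i => (x i : EuclideanSpace ℝ (Fin d))))) ∧
    (∀ (d : ℕ) (p : Fin (d + 1) → EuclideanSpace ℝ (Fin d)),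
      AffineIndependent ℝ p → Subtransitive.IsSubtransitive (Set.range p)) := by
  refine ⟨fun d hd => ?_, fun d p hp => Subtransitive.isSubtransitive_of_affineIndependent hp⟩
  have h := Subtransitive.ae_not_isAffinelySubtransitive hd
  refine ⟨h, ?_⟩
  filter_upwards [h] with x hx hsub
  exact hx (hsub.isAffinelySubtransitive (by omega))
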